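/- Let $r\ge 0$ and let $F$ be the free group with basis $A=\{a_1,\dots,a_r\}$. For $g\in F$ let $|g|$ be the least length of a word in $A\cup A^{-1}$ representing $g$, and let $d(g,h)=|g^{-1}h|$ be the word metric. Then there is a deterministic algorithm (depending only on $r$) and a polynomial $p$ such that the following holds. The input is a pair of finite lists $(u_1,\dots,u_m)$ and $(v_1,\dots,v_n)$ of (not necessarily reduced) words in $A\cup A^{-1}$; let $H=\langle u_1,\dots,u_m\rangle$ and $K=\langle v_1,\dots,v_n\rangle$ be the subgroups of $F$ that they generate. The algorithm halts after at most $p(N)$ steps, where $N=m+n+\sum_i|u_i|+\sum_j|v_j|$ with $|u_i|,|v_j|$ the lengths of these words. If $H$ and $K$ are not both trivial, it outputs words representing elements $h\in H$ and $k\in K$, not both trivial, such that $d(h,k)\le d(h',k')$ for all $h'\in H$ and $k'\in K$ that are not both trivial; if $H$ and $K$ are both trivial, it reports that no such pair exists. (Algorithms are formalized as while-programs on binary trees in which each operation is charged the sizes of the trees it handles, a model polynomially equivalent to Turing machines.) -/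

import Mathlib

/-! ### The machine model: while-programs on binary trees

Programs act on finitely many variables (those they mention) that hold finite binary trees, and
use the LISP-like operations `nil`, `cons`, `hd`, `tl`, an equality test, assignment, composition,
branching and while-loops. Every evaluation of an expression is charged the total size of the
trees that occur as values of its subexpressions, in addition to one unit per executed command.
So there is no free sharing or copying of data: within `t` units of time the total size of the
store grows by at most `t`, and a multitape Turing machine that keeps the variables as serialized
trees simulates the program in time polynomial in `t` and in the size of the input. Conversely a
Turing machine with its tapes kept as pairs of lists is simulated with polynomial overhead.
Polynomial time in this model is thus the usual polynomial time. -/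

namespace TreeWhile

/-- Finite binary trees, the data of the programs. -/
inductive Data : Type
  | nil : Data
  | cons : Data → Data → Data
  deriving DecidableEq

/-- The number of nodes of a tree, leaves included. -/
def Data.size : Data → ℕ
  | .nil => 1
  | .cons a b => a.size + b.size + 1

/-- The left subtree (`nil` for `nil`). -/
def Data.hd : Data → Data
  | .nil => .nil
  | .cons a _ => a

/-- The right subtree (`nil` for `nil`). -/
def Data.tl : Data → Data
  | .nil => .nil
  | .cons _ b => b

/-- Truth values: `nil` is false, every other tree counts as true. -/
def Data.ofBool : Bool → Data
  | false => .nil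
  | true => .cons .nil .nil

/-- A store assigns a tree to each variable. -/
abbrev Store : Type := ℕ → Data

inductive Expr : Type
  | var : ℕ → Expr
  | nil : Expr
  | cons : Expr → Expr → Expr
  | hd : Expr → Expr
  | tl : Expr → Expr
  | eq : Expr → Expr → Expr

def Expr.eval (s : Store) : Expr → Data
  | .var x => s x
  | .nil => .nil
  | .cons e f => .cons (e.eval s) (f.eval s)
  | .hd e => (e.eval s).hd
  | .tl e => (e.eval s).tl
  | .eq e f => Data.ofBool (decide (e.eval s = f.eval s))

/-- The time to evaluate an expression: the sum of the sizes of the values of all its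
subexpressions, itself included. -/
def Expr.cost (s : Store) : Expr → ℕ
  | .var x => (s x).size
  | .nil => 1
  | .cons e f => e.cost s + f.cost s + ((Expr.cons e f).eval s).size
  | .hd e => e.cost s + ((Expr.hd e).eval s).size
  | .tl e => e.cost s + ((Expr.tl e).eval s).size
  | .eq e f => e.cost s + f.cost s + ((Expr.eq e f).eval s).size

inductive Cmd : Type
  | skip : Cmd
  | assign : ℕ → Expr → Cmd
  | seq : Cmd → Cmd → Cmd
  | ite : Expr → Cmd → Cmd → Cmd
  | loop : Expr → Cmd → Cmd

/-- `Run c s t s'`: started in the store `s`, the program `c` halts after exactly `t` units of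
time in the store `s'`. The command `loop e c` repeats `c` as long as `e` is true. -/
inductive Run : Cmd → Store → ℕ → Store → Prop
  | skip (s : Store) : Run .skip s 1 s
  | assign (x : ℕ) (e : Expr) (s : Store) :
      Run (.assign x e) s (e.cost s + 1) (Function.update s x (e.eval s))
  | seq {c d : Cmd} {s s' s'' : Store} {t t' : ℕ} :
      Run c s t s' → Run d s' t' s'' → Run (.seq c d) s (t + t') s''
  | iteTrue {e : Expr} {c d : Cmd} {s s' : Store} {t : ℕ} :
      e.eval s ≠ .nil → Run c s t s' → Run (.ite e c d) s (e.cost s + 1 + t) s'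
  | iteFalse {e : Expr} {c d : Cmd} {s s' : Store} {t : ℕ} :
      e.eval s = .nil → Run d s t s' → Run (.ite e c d) s (e.cost s + 1 + t) s'
  | loopDone {e : Expr} {c : Cmd} {s : Store} :
      e.eval s = .nil → Run (.loop e c) s (e.cost s + 1) s
  | loopStep {e : Expr} {c : Cmd} {s s' s'' : Store} {t t' : ℕ} :
      e.eval s ≠ .nil → Run c s t s' → Run (.loop e c) s' t' s'' →
        Run (.loop e c) s (e.cost s + 1 + t + t') s''

/-- The initial store: the input is in variable `0`, all other variables hold `nil`. -/
def Store.init (d : Data) : Store := Function.update (fun _ => Data.nil) 0 d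

/-- Started on the input `d`, the program `c` halts after exactly `t` units of time with the
output `o` in variable `0`. -/
def Outputs (c : Cmd) (d : Data) (t : ℕ) (o : Data) : Prop :=
  ∃ s : Store, Run c (Store.init d) t s ∧ s 0 = o

/-- Programs are deterministic: running time and final store are determined by the start. -/
theorem Run.det {c : Cmd} {s s₁ s₂ : Store} {t₁ t₂ : ℕ}
    (h₁ : Run c s t₁ s₁) (h₂ : Run c s t₂ s₂) : t₁ = t₂ ∧ s₁ = s₂ := by
  induction h₁ generalizing t₂ s₂ with
  | skip s => cases h₂; exact ⟨rfl, rfl⟩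
  | assign x e s => cases h₂; exact ⟨rfl, rfl⟩
  | seq _ _ ih ih' =>
    cases h₂ with
    | seq a b =>
      obtain ⟨rfl, rfl⟩ := ih a
      obtain ⟨rfl, rfl⟩ := ih' b
      exact ⟨rfl, rfl⟩
  | iteTrue h _ ih =>
    cases h₂ with
    | iteTrue _ a => obtain ⟨rfl, rfl⟩ := ih a; exact ⟨rfl, rfl⟩
    | iteFalse h' _ => exact absurd h' h
  | iteFalse h _ ih =>
    cases h₂ with
    | iteTrue h' _ => exact absurd h h'
    | iteFalse _ a => obtain ⟨rfl, rfl⟩ := ih a; exact ⟨rfl, rfl⟩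
  | loopDone h =>
    cases h₂ with
    | loopDone _ => exact ⟨rfl, rfl⟩
    | loopStep h' _ _ => exact absurd h h'
  | loopStep h _ _ ih ih' =>
    cases h₂ with
    | loopDone h' => exact absurd h' h
    | loopStep _ a b =>
      obtain ⟨rfl, rfl⟩ := ih a
      obtain ⟨rfl, rfl⟩ := ih' b
      exact ⟨rfl, rfl⟩

/-- A list of trees as a tree. -/
def Data.ofList : List Data → Data
  | [] => .nil
  | a :: l => .cons a (Data.ofList l)

/-- A natural number in unary. -/
def Data.ofNat : ℕ → Data
  | 0 => .nil
  | n + 1 => .cons .nil (Data.ofNat n)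

end TreeWhile

/-! ### The subgroup distance problem in the free group of rank `r` -/

namespace SubgroupDistance

open TreeWhile

/-- Group words in the free generators and their inverses, not necessarily reduced; `(i, true)` is
the generator `i` and `(i, false)` its inverse, so that a word `w` represents `FreeGroup.mk w`. -/
abbrev Word (r : ℕ) : Type := List (Fin r × Bool)

/-- The subgroup generated by the elements that the given words represent. -/
def subgroupOf {r : ℕ} (L : List (Word r)) : Subgroup (FreeGroup (Fin r)) :=
  Subgroup.closure {g | ∃ w ∈ L, FreeGroup.mk w = g}

/-- The word length with respect to the free generators: the least length of a word that
represents `g`. -/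
noncomputable def wordLength {r : ℕ} (g : FreeGroup (Fin r)) : ℕ :=
  sInf {n | ∃ w : Word r, FreeGroup.mk w = g ∧ w.length = n}

/-- The word length is Mathlib's norm, the length of the reduced word. -/
theorem wordLength_eq_norm {r : ℕ} (g : FreeGroup (Fin r)) : wordLength g = g.norm := by
  apply le_antisymm
  · exact Nat.sInf_le ⟨g.toWord, FreeGroup.mk_toWord, rfl⟩
  · obtain ⟨w, rfl, hl⟩ := Nat.sInf_mem (s := {n | ∃ w : Word r, FreeGroup.mk w = g ∧ w.length = n})
      ⟨_, g.toWord, FreeGroup.mk_toWord, rfl⟩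
    exact FreeGroup.norm_mk_le.trans hl.le

/-- The word metric. -/
noncomputable def wordDist {r : ℕ} (g h : FreeGroup (Fin r)) : ℕ := wordLength (g⁻¹ * h)

/-- The correct answers for the subgroups `H` and `K`: two words representing elements of `H` and
`K`, not both trivial, at the least distance among all such pairs; or `none`, if no pair of
elements of `H` and `K` that are not both trivial exists. -/
def IsAnswer {r : ℕ} (H K : Subgroup (FreeGroup (Fin r))) : Option (Word r × Word r) → Prop
  | some (u, v) =>
      FreeGroup.mk u ∈ H ∧ FreeGroup.mk v ∈ K ∧ ¬ (FreeGroup.mk u = 1 ∧ FreeGroup.mk v = 1) ∧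
        ∀ h ∈ H, ∀ k ∈ K, ¬ (h = 1 ∧ k = 1) →
          wordDist (FreeGroup.mk u) (FreeGroup.mk v) ≤ wordDist h k
  | none => ∀ h ∈ H, ∀ k ∈ K, h = 1 ∧ k = 1

def encodeLetter {r : ℕ} (a : Fin r × Bool) : Data :=
  .cons (Data.ofNat a.1) (Data.ofBool a.2)

def encodeWord {r : ℕ} (w : Word r) : Data := Data.ofList (w.map encodeLetter)

def encodeWords {r : ℕ} (L : List (Word r)) : Data := Data.ofList (L.map encodeWord)

def encodeInput {r : ℕ} (L M : List (Word r)) : Data := .cons (encodeWords L) (encodeWords M)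

def encodeAnswer {r : ℕ} : Option (Word r × Word r) → Data
  | none => .nil
  | some (u, v) => .cons (encodeWord u) (encodeWord v)

/-- The size of an input: the number of its words plus their total length. -/
def inputSize {r : ℕ} (L M : List (Word r)) : ℕ :=
  ((L ++ M).map fun w => w.length + 1).sum

end SubgroupDistance

/-! ### Polynomial-time functions in the tree model -/

namespace TreeWhile

/-! Each subgroup is replaced by its folded Stallings graph. Words are read from right to left, so a
walk labelled `w` from the base point ends at a vertex standing for the coset of `w`. The folded
graph is deterministic and closed under reversing edges. Hence the reduced word of every element of
the subgroup labels a closed walk at the base point (`reach_toWord_of_mem`), and two words leading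
to the same vertex differ by an element of the subgroup (`mem_of_reach_stallings`).

If some nonempty reduced word is closed in the product of the two graphs, it lies in both subgroups
and gives distance `0`. Otherwise the intersection is trivial and every admissible pair has `h ≠ k`.
Write the reduced words as `h = uv` and `k = uw` with `u` their longest common prefix, so that the
distance is `|v| + |w|`. Then `v` leads to a vertex `p` of the first graph, `w` to a vertex `q` of
the second, and the inverse of `u` leads from the pair of base points to `(p, q)` in the product.
Conversely, let `z` lead to `(p, q)` in the product, and let reduced `v`, `w` lead to `p`, `q` and
not begin with the same letter. Then `z⁻¹v` and `z⁻¹w` form an admissible pair at distance exactly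
`|v| + |w|` (`wordDist_eq`), whatever `z` is. So it suffices to know, for each vertex and each first
letter, a shortest reduced word leading there.

Whether a reduced word can be prolonged depends only on its last edge. A walk that repeats an edge
can therefore be cut short, lengths up to the number of edges suffice, and one word per last edge
and length is enough (`explore_complete`). Folding also ends within as many rounds as there are
edges, since each fold loses a vertex (`foldGraph_deterministic`).

For the running time, `PolyTime` is shown to be closed under composition, pairing, branching and
iteration along a list with polynomially bounded intermediate results (`PolyTime.foldl`). The
algorithm is written with these operations alone, so what remains are size bounds for the values
built by its loops. -/

theorem polynomial_eval_mono (p : Polynomial ℕ) {m n : ℕ} (h : m ≤ n) : p.eval m ≤ p.eval n := by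
  rw [Polynomial.eval_eq_sum, Polynomial.eval_eq_sum, Polynomial.sum, Polynomial.sum]
  gcongr

theorem Data.one_le_size (d : Data) : 1 ≤ d.size := by
  cases d <;> simp [Data.size]

theorem Data.tl_size_le (d : Data) : d.tl.size ≤ d.size := by
  cases d with
  | nil => exact le_rfl
  | cons a b => simp only [Data.size, Data.tl]; omega

theorem Data.ofBool_size_le (b : Bool) : (Data.ofBool b).size ≤ 3 := by
  cases b <;> simp [Data.size, Data.ofBool]

theorem Data.ofNat_size (n : ℕ) : (Data.ofNat n).size = 2 * n + 1 := by
  induction n with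
  | zero => rfl
  | succ n ih => simp only [Data.ofNat, Data.size, ih]; ring

theorem Data.ofNat_injective : Function.Injective Data.ofNat := by
  intro m n h
  have := congrArg Data.size h
  simpa [Data.ofNat_size] using this

theorem Data.ofList_injective : Function.Injective Data.ofList := by
  intro l
  induction l with
  | nil => intro m h; cases m <;> simp_all [Data.ofList]
  | cons a l ih =>
    intro m h
    cases m with
    | nil => simp [Data.ofList] at h
    | cons b m =>
      simp only [Data.ofList, Data.cons.injEq] at h
      rw [h.1, ih h.2]

theorem Expr.eval_size_le_cost (s : Store) (e : Expr) : (e.eval s).size ≤ e.cost s := by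
  cases e <;> simp [Expr.eval, Expr.cost, Data.size]

/-- An injective encoding by trees. -/
class Enc (α : Type) where
  enc : α → Data
  enc_injective : Function.Injective enc

/-- The size of the encoding. -/
def esize {α : Type} [Enc α] (a : α) : ℕ := (Enc.enc a).size

open Enc (enc)

instance : Enc Data := ⟨id, Function.injective_id⟩

instance : Enc Bool := ⟨Data.ofBool, by intro a b; cases a <;> cases b <;> simp [Data.ofBool]⟩

instance (r : ℕ) : Enc (Fin r) :=
  ⟨fun i => Data.ofNat i, fun _ _ h => Fin.ext (Data.ofNat_injective h)⟩

instance {α β : Type} [Enc α] [Enc β] : Enc (α × β) :=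
  ⟨fun x => .cons (enc x.1) (enc x.2), by
    rintro ⟨a, b⟩ ⟨c, d⟩ h
    simp only [Data.cons.injEq] at h
    rw [Enc.enc_injective h.1, Enc.enc_injective h.2]⟩

instance {α : Type} [Enc α] : Enc (List α) :=
  ⟨fun l => Data.ofList (l.map enc), fun _ _ h =>
    List.map_injective_iff.2 Enc.enc_injective (Data.ofList_injective h)⟩

/-! ### Sizes of encoded pairs and lists. -/

section esize

variable {α β : Type} [Enc α] [Enc β]

theorem one_le_esize (a : α) : 1 ≤ esize a := Data.one_le_size _

@[simp] theorem esize_mk (a : α) (b : β) : esize (a, b) = esize a + esize b + 1 := rfl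

@[simp] theorem esize_nil : esize ([] : List α) = 1 := rfl

@[simp] theorem esize_cons (a : α) (l : List α) : esize (a :: l) = esize a + esize l + 1 := rfl

theorem esize_fst_le (x : α × β) : esize x.1 ≤ esize x := by
  rcases x with ⟨a, b⟩; simp only [esize_mk]; omega

theorem esize_snd_le (x : α × β) : esize x.2 ≤ esize x := by
  rcases x with ⟨a, b⟩; simp only [esize_mk]; omega

theorem esize_append_add_one (l m : List α) : esize (l ++ m) + 1 = esize l + esize m := by
  induction l with
  | nil => simp; omega
  | cons a l ih => simp only [List.cons_append, esize_cons]; omega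

theorem esize_reverse (l : List α) : esize l.reverse = esize l := by
  induction l with
  | nil => rfl
  | cons a l ih =>
    have := esize_append_add_one l.reverse [a]
    simp only [List.reverse_cons, esize_cons, esize_nil] at *
    omega

theorem esize_le_of_mem {a : α} {l : List α} (h : a ∈ l) : esize a + 2 ≤ esize l := by
  induction l with
  | nil => simp at h
  | cons b l ih =>
    have := one_le_esize l
    have := one_le_esize b
    simp only [esize_cons]
    rcases List.mem_cons.1 h with rfl | h
    · omega
    · have := ih h; omega

theorem esize_le_of_prefix {l m : List α} (h : l <+: m) : esize l ≤ esize m := by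
  obtain ⟨k, rfl⟩ := h
  have := esize_append_add_one l k
  have := one_le_esize k
  omega

theorem length_lt_esize (l : List α) : l.length < esize l := by
  induction l with
  | nil => simp
  | cons a l ih => simp only [List.length_cons, esize_cons]; omega

theorem esize_list_le {l : List α} {B : ℕ} (h : ∀ a ∈ l, esize a ≤ B) :
    esize l ≤ l.length * (B + 1) + 1 := by
  induction l with
  | nil => simp
  | cons a l ih =>
    have h1 := ih fun b hb => h b (List.mem_cons_of_mem _ hb)
    have h2 := h a List.mem_cons_self
    simp only [esize_cons, List.length_cons, add_mul]
    omega

end esize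

/-- `c` computes `f` from the variable `k` to the variable `k` within the time bound `p`, and does
not change the variables below `k`. -/
def ComputesAt {α β : Type} [Enc α] [Enc β] (c : Cmd) (k : ℕ) (f : α → β) (p : Polynomial ℕ) :
    Prop :=
  ∀ (s : Store) (a : α), s k = enc a → ∃ (t : ℕ) (s' : Store), Run c s t s' ∧
    s' k = enc (f a) ∧ (∀ j < k, s' j = s j) ∧ t ≤ p.eval (esize a)

/-- The functions computable in polynomial time. -/
@[fun_prop]
def PolyTime {α β : Type} [Enc α] [Enc β] (f : α → β) : Prop :=
  ∃ p : Polynomial ℕ, (∀ a, esize (f a) ≤ p.eval (esize a)) ∧ ∀ k, ∃ c, ComputesAt c k f p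

/-! ### Closure properties of the polynomial-time functions. -/

namespace PolyTime

variable {α β γ δ : Type} [Enc α] [Enc β] [Enc γ] [Enc δ]

/-- A single assignment does it. The cost of an expression includes the size of its value, so one
polynomial bounds both time and output size. -/
theorem of_expr {f : α → β} (e : ℕ → Expr) (p : Polynomial ℕ)
    (h : ∀ k s a, s k = enc a →
      (e k).eval s = enc (f a) ∧ (e k).cost s ≤ p.eval (esize a)) : PolyTime f := by
  refine ⟨p + 1, fun a => ?_, fun k => ⟨.assign k (e k), fun s a hs => ?_⟩⟩
  · obtain ⟨h1, h2⟩ := h 0 (fun _ => enc a) a rfl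
    have := Expr.eval_size_le_cost (fun _ => enc a) (e 0)
    rw [h1] at this
    simp only [Polynomial.eval_add, Polynomial.eval_one]
    exact (this.trans h2).trans (Nat.le_succ _)
  · obtain ⟨h1, h2⟩ := h k s a hs
    refine ⟨_, _, .assign k (e k) s, by simp [h1], fun j hj => ?_, by simpa using h2⟩
    rw [Function.update_of_ne hj.ne]

@[fun_prop]
theorem id' : PolyTime (fun a : α => a) :=
  of_expr (fun k => .var k) Polynomial.X fun k s a hs => by
    simp [Expr.eval, Expr.cost, hs, esize]

@[fun_prop]
theorem const (b : β) : PolyTime (fun _ : α => b) := by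
  -- A fixed tree is the value of an expression without variables, whose cost does not depend on the
  -- store.
  have key : ∀ d : Data, ∃ e : Expr, ∃ n, ∀ s, e.eval s = d ∧ e.cost s ≤ n := by
    intro d
    induction d with
    | nil => exact ⟨.nil, 1, fun s => ⟨rfl, le_rfl⟩⟩
    | cons a b iha ihb =>
      obtain ⟨e, n, he⟩ := iha
      obtain ⟨f, m, hf⟩ := ihb
      refine ⟨.cons e f, n + m + (Data.cons a b).size, fun s => ⟨by simp [Expr.eval, he, hf], ?_⟩⟩
      simp only [Expr.cost, Expr.eval, (he s).1, (hf s).1]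
      have := (he s).2
      have := (hf s).2
      omega
  obtain ⟨e, n, he⟩ := key (enc b)
  exact of_expr (fun _ => e) (Polynomial.C n) fun k s a hs => by
    simpa using he s

theorem fst : PolyTime (Prod.fst : α × β → α) :=
  of_expr (fun k => .hd (.var k)) (2 * Polynomial.X) fun k s a hs => by
    refine ⟨by simp [Expr.eval, hs, enc, Data.hd], ?_⟩
    have := esize_fst_le a
    simp only [Expr.cost, Expr.eval, hs, Polynomial.eval_mul, Polynomial.eval_ofNat,
      Polynomial.eval_X]
    change esize a + esize a.1 ≤ _
    omega

theorem snd : PolyTime (Prod.snd : α × β → β) :=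
  of_expr (fun k => .tl (.var k)) (2 * Polynomial.X) fun k s a hs => by
    refine ⟨by simp [Expr.eval, hs, enc, Data.tl], ?_⟩
    have := esize_snd_le a
    simp only [Expr.cost, Expr.eval, hs, Polynomial.eval_mul, Polynomial.eval_ofNat,
      Polynomial.eval_X]
    change esize a + esize a.2 ≤ _
    omega

/-- Functions that do not change the encoding. -/
theorem of_enc_eq {f : α → β} (h : ∀ a, enc (f a) = enc a) : PolyTime f :=
  of_expr (fun k => .var k) Polynomial.X fun k s a hs => by
    simp [Expr.eval, Expr.cost, hs, esize, h]

theorem tail : PolyTime (List.tail : List α → List α) :=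
  of_expr (fun k => .tl (.var k)) (2 * Polynomial.X) fun k s a hs => by
    have h : (enc a).tl = enc a.tail := by cases a <;> rfl
    refine ⟨by simp [Expr.eval, hs, h], ?_⟩
    have := Data.tl_size_le (enc a)
    simp only [Expr.cost, Expr.eval, hs, Polynomial.eval_mul, Polynomial.eval_ofNat,
      Polynomial.eval_X]
    change esize a + _ ≤ 2 * esize a
    change _ ≤ esize a at this
    omega

theorem isEmpty : PolyTime (List.isEmpty : List α → Bool) :=
  of_expr (fun k => .eq (.var k) .nil) (Polynomial.X + 4) fun k s a hs => by
    have h : Data.ofBool (decide (enc a = .nil)) = enc a.isEmpty := by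
      cases a <;> rfl
    refine ⟨by simp [Expr.eval, hs, h], ?_⟩
    have := Data.ofBool_size_le (decide (enc a = .nil))
    simp only [Expr.cost, Expr.eval, hs, Polynomial.eval_add, Polynomial.eval_ofNat,
      Polynomial.eval_X]
    change esize a + _ + _ ≤ esize a + _
    omega

-- The size bound carried by `PolyTime` controls the argument of the second program. Monotonicity of
-- polynomials with natural coefficients then bounds its time.
@[fun_prop]
theorem comp {g : β → γ} {f : α → β} (hg : PolyTime g) (hf : PolyTime f) :
    PolyTime (fun a => g (f a)) := by
  obtain ⟨p, hp, hp'⟩ := hf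
  obtain ⟨q, hq, hq'⟩ := hg
  refine ⟨p + q.comp p, fun a => ?_, fun k => ?_⟩
  · have := hq (f a)
    have := polynomial_eval_mono q (hp a)
    simp only [Polynomial.eval_add, Polynomial.eval_comp]
    omega
  · obtain ⟨c, hc⟩ := hp' k
    obtain ⟨d, hd⟩ := hq' k
    refine ⟨.seq c d, fun s a hs => ?_⟩
    obtain ⟨t, s', h1, h2, h3, h4⟩ := hc s a hs
    obtain ⟨t', s'', h1', h2', h3', h4'⟩ := hd s' _ h2
    refine ⟨_, _, .seq h1 h1', h2', fun j hj => (h3' j hj).trans (h3 j hj), ?_⟩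
    have := polynomial_eval_mono q (hp a)
    simp only [Polynomial.eval_add, Polynomial.eval_comp]
    omega

/-- Copying a variable before a computation keeps the argument. -/
theorem exists_computes_fresh {f : α → β} (hf : PolyTime f) :
    ∃ p : Polynomial ℕ, (∀ a, esize (f a) ≤ p.eval (esize a)) ∧ ∀ k m, k < m → ∃ c,
      ∀ (s : Store) (a : α), s k = enc a → ∃ (t : ℕ) (s' : Store), Run c s t s' ∧
        s' m = enc (f a) ∧ (∀ j < m, s' j = s j) ∧ t ≤ p.eval (esize a) := by
  obtain ⟨p, hp, hp'⟩ := hf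
  refine ⟨p + Polynomial.X + 1, fun a => (hp a).trans (by simp; omega), fun k m hkm => ?_⟩
  obtain ⟨c, hc⟩ := hp' m
  refine ⟨.seq (.assign m (.var k)) c, fun s a hs => ?_⟩
  obtain ⟨t, s', h1, h2, h3, h4⟩ := hc (Function.update s m (enc a)) a (by simp)
  have := Run.assign m (.var k) s
  simp only [Expr.eval, Expr.cost, hs] at this
  refine ⟨_, _, .seq this h1, h2, fun j hj => ?_, ?_⟩
  · rw [h3 j hj, Function.update_of_ne hj.ne]
  · simp only [Polynomial.eval_add, Polynomial.eval_X, Polynomial.eval_one]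
    change esize a + 1 + t ≤ _
    omega

/-- An expression in the values of two polynomial-time functions. -/
theorem of_expr₂ {f : α → β} {g : α → γ} {h : β × γ → δ} (hf : PolyTime f) (hg : PolyTime g)
    (e : Expr → Expr → Expr) (n : ℕ)
    (he : ∀ (s : Store) i j b c, s i = enc b → s j = enc c →
      (e (.var i) (.var j)).eval s = enc (h (b, c)) ∧
      (e (.var i) (.var j)).cost s ≤ n * (esize b + esize c)) :
    PolyTime (fun a => h (f a, g a)) := by
  obtain ⟨p, hp, hp'⟩ := hf.exists_computes_fresh
  obtain ⟨q, hq, hq'⟩ := hg.exists_computes_fresh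
  refine ⟨p + q + 1 + Polynomial.C n * (p + q), fun a => ?_, fun k => ?_⟩
  · obtain ⟨h1, h2⟩ := he (fun i => if i = 0 then enc (f a) else enc (g a)) 0 1 (f a) (g a) rfl rfl
    have h3 := Expr.eval_size_le_cost
      (fun i => if i = 0 then enc (f a) else enc (g a)) (e (.var 0) (.var 1))
    rw [h1] at h3
    have := (h3.trans h2).trans (Nat.mul_le_mul_left n (add_le_add (hp a) (hq a)))
    simp only [Polynomial.eval_add, Polynomial.eval_mul, Polynomial.eval_C, Polynomial.eval_one]
    exact this.trans (Nat.le_add_left _ _)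
  · obtain ⟨c, hc⟩ := hp' k (k + 1) (by omega)
    obtain ⟨d, hd⟩ := hq' k (k + 2) (by omega)
    refine ⟨.seq c (.seq d (.assign k (e (.var (k + 1)) (.var (k + 2))))), fun s a hs => ?_⟩
    obtain ⟨t, s', h1, h2, h3, h4⟩ := hc s a hs
    obtain ⟨t', s'', h1', h2', h3', h4'⟩ := hd s' a (by rw [h3 k (by omega), hs])
    obtain ⟨h5, h6⟩ := he s'' (k + 1) (k + 2) (f a) (g a)
      (by rw [h3' (k + 1) (by omega), h2]) h2'
    refine ⟨_, _, .seq h1 (.seq h1' (.assign k _ s'')), by simp [h5], fun j hj => ?_, ?_⟩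
    · rw [Function.update_of_ne hj.ne, h3' j (by omega), h3 j (by omega)]
    · have := h6.trans (Nat.mul_le_mul_left n (add_le_add (hp a) (hq a)))
      simp only [Polynomial.eval_add, Polynomial.eval_mul, Polynomial.eval_C, Polynomial.eval_one]
      omega

@[fun_prop]
theorem pair {f : α → β} {g : α → γ} (hf : PolyTime f) (hg : PolyTime g) :
    PolyTime (fun a => (f a, g a)) :=
  of_expr₂ (h := fun x => x) hf hg .cons 3 fun s i j b c hi hj => by
    refine ⟨by simp [Expr.eval, hi, hj, enc], ?_⟩
    have := one_le_esize b
    simp only [Expr.cost, Expr.eval, hi, hj, Data.size]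
    change esize b + esize c + (esize b + esize c + 1) ≤ _
    omega

@[fun_prop]
theorem cons {f : α → β} {g : α → List β} (hf : PolyTime f) (hg : PolyTime g) :
    PolyTime (fun a => f a :: g a) :=
  of_expr₂ (h := fun x => x.1 :: x.2) hf hg .cons 3 fun s i j b c hi hj => by
    refine ⟨by simp [Expr.eval, hi, hj, enc, Data.ofList], ?_⟩
    have := one_le_esize b
    simp only [Expr.cost, Expr.eval, hi, hj, Data.size]
    change esize b + esize c + (esize b + esize c + 1) ≤ _
    omega

-- Injectivity of the encoding makes the equality test on trees decide equality of the encoded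
-- values.
@[fun_prop]
theorem decide_eq [DecidableEq β] {f g : α → β} (hf : PolyTime f) (hg : PolyTime g) :
    PolyTime (fun a => decide (f a = g a)) :=
  of_expr₂ (h := fun x => decide (x.1 = x.2)) hf hg .eq 4 fun s i j b c hi hj => by
    refine ⟨by simp [Expr.eval, hi, hj, Enc.enc_injective.eq_iff]; rfl, ?_⟩
    have := one_le_esize b
    simp only [Expr.cost, Expr.eval, hi, hj]
    have := Data.ofBool_size_le (decide (enc b = enc c))
    change esize b + esize c + _ ≤ _
    omega

@[fun_prop]
theorem fst' {f : α → β × γ} (hf : PolyTime f) : PolyTime (fun a => (f a).1) := fst.comp hf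

@[fun_prop]
theorem snd' {f : α → β × γ} (hf : PolyTime f) : PolyTime (fun a => (f a).2) := snd.comp hf

@[fun_prop]
theorem cond {b : α → Bool} {f g : α → β} (hb : PolyTime b) (hf : PolyTime f) (hg : PolyTime g) :
    PolyTime (fun a => bif b a then f a else g a) := by
  obtain ⟨o, ho, ho'⟩ := hb.exists_computes_fresh
  obtain ⟨p, hp, hp'⟩ := hf
  obtain ⟨q, hq, hq'⟩ := hg
  refine ⟨2 * o + p + q + 1, fun a => ?_, fun k => ?_⟩
  · have := hp a
    have := hq a
    simp only [Polynomial.eval_add, Polynomial.eval_one]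
    cases b a <;> simp only [cond_true, cond_false] <;> omega
  · obtain ⟨c, hc⟩ := ho' k (k + 1) (by omega)
    obtain ⟨d, hd⟩ := hp' k
    obtain ⟨e, he⟩ := hq' k
    refine ⟨.seq c (.ite (.var (k + 1)) d e), fun s a hs => ?_⟩
    obtain ⟨t, s', h1, h2, h3, h4⟩ := hc s a hs
    have h5 : (Expr.var (k + 1)).cost s' = esize (b a) := by
      rw [Expr.cost, h2]; rfl
    have h6 := ho a
    simp only [Polynomial.eval_add, Polynomial.eval_one, Polynomial.eval_mul,
      Polynomial.eval_ofNat]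
    cases hba : b a with
    | true =>
      obtain ⟨t', s'', h1', h2', h3', h4'⟩ := hd s' a (by rw [h3 k (by omega), hs])
      refine ⟨_, s'', .seq h1 (.iteTrue ?_ h1'), by simpa using h2',
        fun j hj => by rw [h3' j hj, h3 j (by omega)], ?_⟩
      · simp [Expr.eval, h2, hba, enc, Data.ofBool]
      · omega
    | false =>
      obtain ⟨t', s'', h1', h2', h3', h4'⟩ := he s' a (by rw [h3 k (by omega), hs])
      refine ⟨_, s'', .seq h1 (.iteFalse ?_ h1'), by simpa using h2',
        fun j hj => by rw [h3' j hj, h3 j (by omega)], ?_⟩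
      · simp [Expr.eval, h2, hba, enc, Data.ofBool]
      · omega

end PolyTime

end TreeWhile

/-! ### List processing in polynomial time. -/

namespace TreeWhile

open Enc (enc)

/-- Case distinction on the first entry of a list. -/
def headElim {β γ : Type} (l : List β) (n : γ) (s : β → γ) : γ :=
  match l with
  | [] => n
  | b :: _ => s b

@[simp] theorem headElim_nil {β γ : Type} (n : γ) (s : β → γ) : headElim [] n s = n := rfl

@[simp] theorem headElim_cons {β γ : Type} (b : β) (l : List β) (n : γ) (s : β → γ) :
    headElim (b :: l) n s = s b := rfl

namespace PolyTime

variable {α β γ δ : Type} [Enc α] [Enc β] [Enc γ] [Enc δ]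

/-- There are no closures in the machine model, so the program for the nonempty case receives the
pair of the original argument and the head of the list. -/
theorem headElim {l : α → List β} {n : α → γ} {h : α → β → γ} (hl : PolyTime l)
    (hn : PolyTime n) (hh : PolyTime (fun x : α × β => h x.1 x.2)) :
    PolyTime (fun a => headElim (l a) (n a) (h a)) := by
  obtain ⟨o, ho, ho'⟩ := hl.exists_computes_fresh
  obtain ⟨p, hp, hp'⟩ := hn
  obtain ⟨q, hq, hq'⟩ := hh
  refine ⟨6 * o + p + q.comp (Polynomial.X + o + 1) + 3 * Polynomial.X + 5, fun a => ?_,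
    fun k => ?_⟩
  · have h1 := ho a
    have h2 := hp a
    simp only [Polynomial.eval_add, Polynomial.eval_one, Polynomial.eval_mul,
      Polynomial.eval_ofNat, Polynomial.eval_comp, Polynomial.eval_X]
    cases hla : l a with
    | nil => rw [headElim_nil]; omega
    | cons b m =>
      rw [headElim_cons]
      rw [hla, esize_cons] at h1
      have h3 := hq (a, b)
      have := polynomial_eval_mono q (m := esize (a, b)) (n := esize a + o.eval (esize a) + 1)
        (by simp only [esize_mk]; omega)
      simp only at h3
      omega
  · obtain ⟨c, hc⟩ := ho' k (k + 1) (by omega)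
    obtain ⟨d, hd⟩ := hp' k
    obtain ⟨e, he⟩ := hq' k
    refine ⟨.seq c (.ite (.var (k + 1))
      (.seq (.assign k (.cons (.var k) (.hd (.var (k + 1))))) e) d), fun s a hs => ?_⟩
    obtain ⟨t, s', h1, h2, h3, h4⟩ := hc s a hs
    have hk : s' k = enc a := by rw [h3 k (by omega), hs]
    have h5 : (Expr.var (k + 1)).cost s' = esize (l a) := by
      rw [Expr.cost, h2]; rfl
    have h6 := ho a
    simp only [Polynomial.eval_add, Polynomial.eval_one, Polynomial.eval_mul,
      Polynomial.eval_ofNat, Polynomial.eval_comp, Polynomial.eval_X]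
    cases hla : l a with
    | nil =>
      obtain ⟨t', s'', h1', h2', h3', h4'⟩ := hd s' a hk
      refine ⟨_, s'', .seq h1 (.iteFalse ?_ h1'), by simpa using h2',
        fun j hj => by rw [h3' j hj, h3 j (by omega)], ?_⟩
      · simp [Expr.eval, h2, hla, enc, Data.ofList]
      · omega
    | cons b m =>
      have hv : (Expr.cons (.var k) (.hd (.var (k + 1)))).eval s' = enc (a, b) := by
        simp [Expr.eval, h2, hk, hla, enc, Data.ofList, Data.hd]
      have hcost : (Expr.cons (.var k) (.hd (.var (k + 1)))).cost s' =
          esize a + (esize (l a) + esize b) + esize (a, b) := by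
        rw [Expr.cost, hv]
        simp [Expr.cost, Expr.eval, h2, hk, hla, enc, Data.ofList, Data.hd, esize]
      obtain ⟨t', s'', h1', h2', h3', h4'⟩ := he (Function.update s' k (enc (a, b))) (a, b)
        (by simp)
      have hr := Run.assign k (.cons (.var k) (.hd (.var (k + 1)))) s'
      rw [hv, hcost] at hr
      refine ⟨_, s'', .seq h1 (.iteTrue ?_ (.seq hr h1')), by simpa using h2',
        fun j hj => by rw [h3' j hj, Function.update_of_ne hj.ne, h3 j (by omega)], ?_⟩
      · simp [Expr.eval, h2, hla, enc, Data.ofList]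
      · rw [h5]
        rw [hla, esize_cons] at h6 ⊢
        have := polynomial_eval_mono q (m := esize (a, b)) (n := esize a + o.eval (esize a) + 1)
          (by simp only [esize_mk]; omega)
        simp only [esize_mk] at *
        omega

/-- Iteration along a list, with a polynomial bound for the intermediate results. -/
theorem foldl {l : α → List β} {start : α → γ} {g : α → γ → β → γ} (q : Polynomial ℕ)
    (hl : PolyTime l) (hi : PolyTime start) (hg : PolyTime (fun x : α × γ × β => g x.1 x.2.1 x.2.2))
    (hq : ∀ a m, m <+: l a → esize (m.foldl (g a) (start a)) ≤ q.eval (esize a)) :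
    PolyTime (fun a => (l a).foldl (g a) (start a)) := by
  obtain ⟨p, hp, hp'⟩ := hl.exists_computes_fresh
  obtain ⟨o, ho, ho'⟩ := hi.exists_computes_fresh
  obtain ⟨u, hu, hu'⟩ := hg
  -- `T` bounds the time of one round of the loop
  let T : Polynomial ℕ := u.comp (Polynomial.X + q + p + 2) + 20 * (Polynomial.X + q + p + 2)
  refine ⟨p + o + 3 * q + 3 + (p + 1) * T, fun a => ?_, fun k => ?_⟩
  · have := hq a (l a) List.prefix_rfl
    simp only [Polynomial.eval_add, Polynomial.eval_mul, Polynomial.eval_ofNat]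
    omega
  obtain ⟨c, hc⟩ := hp' k (k + 1) (by omega)
  obtain ⟨d, hd⟩ := ho' k (k + 2) (by omega)
  obtain ⟨e, he⟩ := hu' (k + 3)
  let body : Cmd := .seq (.assign (k + 3)
      (.cons (.var k) (.cons (.var (k + 2)) (.hd (.var (k + 1))))))
    (.seq e (.seq (.assign (k + 2) (.var (k + 3))) (.assign (k + 1) (.tl (.var (k + 1))))))
  refine ⟨.seq c (.seq d (.seq (.loop (.var (k + 1)) body) (.assign k (.var (k + 2))))),
    fun s a hs => ?_⟩
  -- Loop invariant: `m` is the part already consumed, `m'` the remainder held in variable `k + 1`,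
  -- and variable `k + 2` holds the accumulator for `m`. Since `m` is a prefix of `l a`, `hq` bounds
  -- the accumulator in every round.
  have hloop : ∀ (m' m : List β) (s : Store), m ++ m' = l a → s k = enc a → s (k + 1) = enc m' →
      s (k + 2) = enc (m.foldl (g a) (start a)) →
      ∃ t s', Run (.loop (.var (k + 1)) body) s t s' ∧
        s' (k + 2) = enc ((l a).foldl (g a) (start a)) ∧ (∀ j < k + 1, s' j = s j) ∧
        t ≤ (m'.length + 1) * T.eval (esize a) := by
    intro m'
    induction m' with
    | nil =>
      intro m s hm h0 h1 h2
      refine ⟨_, s, .loopDone (by simp [Expr.eval, h1, enc, Data.ofList]), ?_, fun _ _ => rfl, ?_⟩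
      · rw [h2, ← hm, List.append_nil]
      · simp only [Expr.cost, h1]
        change 1 + 1 ≤ _
        simp [T]
        omega
    | cons b m' ih =>
      intro m s hm h0 h1 h2
      have hb1 : esize (m.foldl (g a) (start a)) ≤ q.eval (esize a) := hq a m ⟨_, hm⟩
      have hb2 : esize (g a (m.foldl (g a) (start a)) b) ≤ q.eval (esize a) := by
        have := hq a (m ++ [b]) ⟨m', by simp [hm]⟩
        simpa using this
      have hb3 : esize (b :: m') ≤ p.eval (esize a) := by
        have h3 := hp a
        rw [← hm] at h3
        have := esize_append_add_one m (b :: m')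
        have := one_le_esize m
        omega
      rw [esize_cons] at hb3
      set acc := m.foldl (g a) (start a) with hacc
      have hv : (Expr.cons (.var k) (.cons (.var (k + 2)) (.hd (.var (k + 1))))).eval s =
          enc (a, acc, b) := by
        simp [Expr.eval, h0, h1, h2, enc, Data.ofList, Data.hd]
      have hcost : (Expr.cons (.var k) (.cons (.var (k + 2)) (.hd (.var (k + 1))))).cost s =
          esize a + (esize acc + (esize (b :: m') + esize b) + esize (acc, b)) +
            esize (a, acc, b) := by
        rw [Expr.cost, hv]
        simp [Expr.cost, Expr.eval, h0, h1, h2, enc, Data.ofList, Data.hd, esize]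
      have r1 := Run.assign (k + 3)
        (.cons (.var k) (.cons (.var (k + 2)) (.hd (.var (k + 1))))) s
      rw [hv, hcost] at r1
      obtain ⟨t2, s2, r2, v2, f2, b2⟩ := he (Function.update s (k + 3) (enc (a, acc, b)))
        (a, acc, b) (by simp)
      have f2' : ∀ j < k + 3, s2 j = s j := fun j hj => by
        rw [f2 j hj, Function.update_of_ne hj.ne]
      have r3 := Run.assign (k + 2) (.var (k + 3)) s2
      simp only [Expr.eval, Expr.cost, v2] at r3
      set s3 := Function.update s2 (k + 2) (enc (g a acc b)) with hs3
      have r4 := Run.assign (k + 1) (.tl (.var (k + 1))) s3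
      have hs31 : s3 (k + 1) = enc (b :: m') := by
        rw [hs3, Function.update_of_ne (by omega), f2' _ (by omega), h1]
      have htl : (enc (b :: m')).tl = enc m' := rfl
      simp only [Expr.eval, Expr.cost, hs31, htl] at r4
      obtain ⟨t5, s5, r5, v5, f5, b5⟩ := ih (m ++ [b]) (Function.update s3 (k + 1) (enc m'))
        (by simp [hm])
        (by rw [Function.update_of_ne (by omega), hs3, Function.update_of_ne (by omega),
          f2' _ (by omega), h0])
        (by simp)
        (by rw [Function.update_of_ne (by omega), hs3]; simp [hacc])
      refine ⟨_, s5, .loopStep (by simp [Expr.eval, h1, enc, Data.ofList])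
        (.seq r1 (.seq r2 (.seq r3 r4))) r5, v5, fun j hj => ?_, ?_⟩
      · rw [f5 j hj, Function.update_of_ne (by omega), hs3, Function.update_of_ne (by omega),
          f2' _ (by omega)]
      · have hc0 : (Expr.var (k + 1)).cost s = esize (b :: m') := by rw [Expr.cost, h1]; rfl
        have hmono := polynomial_eval_mono u (m := esize (a, acc, b))
          (n := esize a + q.eval (esize a) + p.eval (esize a) + 2)
          (by simp only [esize_mk]; omega)
        have hT : T.eval (esize a) =
            u.eval (esize a + q.eval (esize a) + p.eval (esize a) + 2) +
              20 * (esize a + q.eval (esize a) + p.eval (esize a) + 2) := by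
          simp [T]
        rw [hc0, List.length_cons, add_mul (m'.length + 1), one_mul]
        change _ + 1 + (_ + (t2 + (esize (g a acc b) + 1 +
          (esize (b :: m') + esize m' + 1)))) + t5 ≤ _
        simp only [esize_mk, esize_cons] at *
        omega
  obtain ⟨t1, s1, r1, v1, f1, b1⟩ := hc s a hs
  obtain ⟨t2, s2, r2, v2, f2, b2⟩ := hd s1 a (by rw [f1 k (by omega), hs])
  obtain ⟨t3, s3, r3, v3, f3, b3⟩ := hloop (l a) [] s2 rfl
    (by rw [f2 k (by omega), f1 k (by omega), hs]) (by rw [f2 _ (by omega), v1]) v2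
  have r4 := Run.assign k (.var (k + 2)) s3
  simp only [Expr.eval, Expr.cost, v3] at r4
  refine ⟨_, _, .seq r1 (.seq r2 (.seq r3 r4)), by simp, fun j hj => ?_, ?_⟩
  · rw [Function.update_of_ne hj.ne, f3 j (by omega), f2 j (by omega), f1 j (by omega)]
  · have h1 := hq a (l a) List.prefix_rfl
    have h2 : (l a).length + 1 ≤ p.eval (esize a) + 1 := by
      have := length_lt_esize (l a)
      have := hp a
      omega
    have h3 := Nat.mul_le_mul_right (T.eval (esize a)) h2
    simp only [Polynomial.eval_add, Polynomial.eval_mul, Polynomial.eval_ofNat,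
      Polynomial.eval_one]
    change t1 + (t2 + (t3 + (esize ((l a).foldl (g a) (start a)) + 1))) ≤ _
    omega

theorem exists_esize_le {f : α → β} (hf : PolyTime f) :
    ∃ p : Polynomial ℕ, ∀ a, esize (f a) ≤ p.eval (esize a) :=
  hf.imp fun _ h => h.1

@[fun_prop]
theorem reverse {f : α → List β} (hf : PolyTime f) : PolyTime (fun a => (f a).reverse) := by
  obtain ⟨p, hp⟩ := hf.exists_esize_le
  have key : ∀ m : List β, m.foldl (fun acc b => b :: acc) [] = m.reverse := fun m => by simp
  have : PolyTime (fun a => (f a).foldl (fun acc b => b :: acc) []) := by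
    refine foldl p hf (const []) (by fun_prop) fun a m hm => ?_
    rw [key, esize_reverse]
    exact (esize_le_of_prefix hm).trans (hp a)
  simpa only [key] using this

@[fun_prop]
theorem append {f g : α → List β} (hf : PolyTime f) (hg : PolyTime g) :
    PolyTime (fun a => f a ++ g a) := by
  obtain ⟨p, hp⟩ := hf.exists_esize_le
  obtain ⟨q, hq⟩ := hg.exists_esize_le
  have key : ∀ m n : List β, m.foldl (fun acc b => b :: acc) n = m.reverse ++ n :=
    fun m n => by simp
  have : PolyTime (fun a => (f a).reverse.foldl (fun acc b => b :: acc) (g a)) := by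
    refine foldl (p + q) hf.reverse hg (by fun_prop) fun a m hm => ?_
    rw [key]
    have h1 := esize_append_add_one m.reverse (g a)
    have h2 := esize_le_of_prefix hm
    rw [esize_reverse] at h1 h2
    have := hp a
    have := hq a
    simp only [Polynomial.eval_add]
    omega
  simpa only [key, List.reverse_reverse] using this

theorem flatMap {l : α → List β} {g : α → β → List γ} (hl : PolyTime l)
    (hg : PolyTime (fun x : α × β => g x.1 x.2)) : PolyTime (fun a => (l a).flatMap (g a)) := by
  obtain ⟨p, hp⟩ := hl.exists_esize_le
  obtain ⟨q, hq⟩ := hg.exists_esize_le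
  have key : ∀ (m : List β) a, m.foldl (fun acc b => acc ++ g a b) [] = m.flatMap (g a) := by
    intro m a
    suffices h : ∀ n, m.foldl (fun acc b => acc ++ g a b) n = n ++ m.flatMap (g a) by
      simpa using h []
    induction m with
    | nil => simp
    | cons b m ih => intro n; simp [ih]
  have : PolyTime (fun a => (l a).foldl (fun acc b => acc ++ g a b) []) := by
    refine foldl (1 + p * q.comp (Polynomial.X + p + 1)) hl (const [])
      ((by fun_prop : PolyTime (fun x : α × List γ × β => x.2.1)).append
        (hg.comp (by fun_prop : PolyTime (fun x : α × List γ × β => (x.1, x.2.2)))))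
      fun a m hm => ?_
    rw [key]
    have h1 : esize m ≤ p.eval (esize a) := (esize_le_of_prefix hm).trans (hp a)
    have h2 : esize (m.flatMap (g a)) ≤ 1 + m.length * q.eval (esize a + p.eval (esize a) + 1) := by
      clear hm
      induction m with
      | nil => simp
      | cons b m ih =>
        rw [esize_cons] at h1
        have h3 := ih (by omega)
        have h4 := esize_append_add_one (g a b) (m.flatMap (g a))
        have h5 := hq (a, b)
        have h6 := polynomial_eval_mono q (m := esize (a, b))
          (n := esize a + p.eval (esize a) + 1) (by simp only [esize_mk]; omega)
        simp only [List.flatMap_cons, List.length_cons, add_mul]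
        simp only at h5
        omega
    have h3 := length_lt_esize m
    have h4 : m.length ≤ p.eval (esize a) := by omega
    have h5 := Nat.mul_le_mul_right (q.eval (esize a + p.eval (esize a) + 1)) h4
    simp only [Polynomial.eval_add, Polynomial.eval_mul, Polynomial.eval_one, Polynomial.eval_comp,
      Polynomial.eval_X]
    omega
  simpa only [key] using this

theorem map {l : α → List β} {g : α → β → γ} (hl : PolyTime l)
    (hg : PolyTime (fun x : α × β => g x.1 x.2)) : PolyTime (fun a => (l a).map (g a)) := by
  have h := flatMap (g := fun a b => [g a b]) hl (hg.cons (const []))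
  simpa only [← List.map_eq_flatMap] using h

theorem filter {l : α → List β} {g : α → β → Bool} (hl : PolyTime l)
    (hg : PolyTime (fun x : α × β => g x.1 x.2)) : PolyTime (fun a => (l a).filter (g a)) := by
  have h := flatMap (g := fun a b => bif g a b then [b] else []) hl
    (hg.cond (by fun_prop) (by fun_prop))
  have key : ∀ a, (l a).flatMap (fun b => bif g a b then [b] else []) = (l a).filter (g a) := by
    intro a
    induction l a with
    | nil => rfl
    | cons b m ih => cases hb : g a b <;> simp_all
  simpa only [key] using h

@[fun_prop]
theorem and {f g : α → Bool} (hf : PolyTime f) (hg : PolyTime g) :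
    PolyTime (fun a => f a && g a) := by
  have h := hf.cond hg (const false)
  have key : ∀ a, (bif f a then g a else false) = (f a && g a) := fun a => by cases f a <;> rfl
  simpa only [key] using h

@[fun_prop]
theorem not {f : α → Bool} (hf : PolyTime f) : PolyTime (fun a => !f a) := by
  have h := hf.cond (const false) (const true)
  have key : ∀ a, (bif f a then false else true) = !f a := fun a => by cases f a <;> rfl
  simpa only [key] using h

@[fun_prop]
theorem tail' {f : α → List β} (hf : PolyTime f) : PolyTime (fun a => (f a).tail) := tail.comp hf

@[fun_prop]
theorem isEmpty' {f : α → List β} (hf : PolyTime f) : PolyTime (fun a => (f a).isEmpty) :=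
  isEmpty.comp hf

end PolyTime

end TreeWhile

/-! ### Labelled graphs and free groups -/

namespace SubgroupDistance

open TreeWhile FreeGroup

/-- Letters: the generators and their inverses. -/
abbrev Letter (r : ℕ) : Type := Fin r × Bool

/-- The inverse letter. -/
def Letter.inv {r : ℕ} (a : Letter r) : Letter r := (a.1, !a.2)

@[simp] theorem Letter.inv_inv {r : ℕ} (a : Letter r) : a.inv.inv = a := by
  simp [Letter.inv]

/-- Labelled edges: source, label, target. -/
abbrev Edge (r : ℕ) (V : Type) : Type := V × Letter r × V

/-- `Reach E b w q`: the word `w`, read from right to left, labels a walk from `b` to `q`. -/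
def Reach {r : ℕ} {V : Type} (E : List (Edge r V)) (b : V) : Word r → V → Prop
  | [], q => q = b
  | a :: w, q => ∃ m, Reach E b w m ∧ (m, a, q) ∈ E

/-- At most one edge with given source and label. -/
def Deterministic {r : ℕ} {V : Type} (E : List (Edge r V)) : Prop :=
  ∀ m a q q', (m, a, q) ∈ E → (m, a, q') ∈ E → q = q'

/-- The reverse of an edge. -/
def Edge.flip {r : ℕ} {V : Type} (e : Edge r V) : Edge r V := (e.2.2, Letter.inv e.2.1, e.1)

/-- The reverse of every edge is an edge. -/
def Symm {r : ℕ} {V : Type} (E : List (Edge r V)) : Prop :=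
  ∀ m a q, (m, a, q) ∈ E → (q, Letter.inv a, m) ∈ E

section Reach

variable {r : ℕ} {V V' : Type} {E : List (Edge r V)}

theorem reach_append {b q : V} {v w : Word r} :
    Reach E b (v ++ w) q ↔ ∃ m, Reach E b w m ∧ Reach E m v q := by
  induction v generalizing q with
  | nil => simp [Reach]
  | cons a v ih =>
    simp only [List.cons_append, Reach, ih]
    constructor
    · rintro ⟨m, ⟨n, h1, h2⟩, h3⟩
      exact ⟨n, h1, m, h2, h3⟩
    · rintro ⟨n, h1, m, h2, h3⟩
      exact ⟨m, ⟨n, h1, h2⟩, h3⟩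

theorem Reach.mono {F : List (Edge r V)} (h : E ⊆ F) {b q : V} {w : Word r} (hw : Reach E b w q) :
    Reach F b w q := by
  induction w generalizing q with
  | nil => exact hw
  | cons a w ih =>
    obtain ⟨m, h1, h2⟩ := hw
    exact ⟨m, ih h1, h h2⟩

theorem Reach.map (σ : V → V') {b q : V} {w : Word r} (hw : Reach E b w q) :
    Reach (E.map fun e => (σ e.1, e.2.1, σ e.2.2)) (σ b) w (σ q) := by
  induction w generalizing q with
  | nil => exact congrArg σ hw
  | cons a w ih =>
    obtain ⟨m, h1, h2⟩ := hw
    exact ⟨σ m, ih h1, List.mem_map.2 ⟨_, h2, rfl⟩⟩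

theorem Reach.invRev (hE : Symm E) {b q : V} {w : Word r} (hw : Reach E b w q) :
    Reach E q (invRev w) b := by
  induction w generalizing q with
  | nil => exact hw.symm
  | cons a w ih =>
    obtain ⟨m, h1, h2⟩ := hw
    rw [invRev_cons, reach_append]
    exact ⟨m, ⟨q, rfl, hE _ _ _ h2⟩, ih h1⟩

/-- A cancelling pair of letters crosses an edge and then follows its inverse label. By symmetry the
reversed edge has that source and label, and by determinism it is the edge taken, so the walk
returns to where the pair began. -/
theorem Reach.reduce (hd : Deterministic E) (hs : Symm E) {b q : V} {w : Word r}
    (hw : Reach E b w q) : Reach E b (FreeGroup.reduce w) q := by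
  have step : ∀ {v w : Word r}, Red.Step v w → Reach E b v q → Reach E b w q := by
    intro v w h hv
    induction h with
    | @not L₁ L₂ x c =>
      rw [reach_append] at hv ⊢
      obtain ⟨m, ⟨n, ⟨k, h1, h2⟩, h3⟩, h4⟩ := hv
      have h5 := hs _ _ _ h2
      simp only [Letter.inv, Bool.not_not] at h5
      rw [hd _ _ _ _ h3 h5] at h4
      exact ⟨k, h1, h4⟩
  have red : ∀ {v w : Word r}, Red v w → Reach E b v q → Reach E b w q := by
    intro v w h hv
    induction h with
    | refl => exact hv
    | tail _ h ih => exact step h ih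
  exact red reduce.red hw

/-- The edges of the product of two graphs. -/
def prodEdges (E : List (Edge r V)) (F : List (Edge r V')) : List (Edge r (V × V')) :=
  E.flatMap fun e => F.flatMap fun f =>
    bif decide (e.2.1 = f.2.1) then [((e.1, f.1), e.2.1, (e.2.2, f.2.2))] else []

theorem mem_prodEdges {F : List (Edge r V')} {m q : V} {m' q' : V'} {a : Letter r} :
    ((m, m'), a, (q, q')) ∈ prodEdges E F ↔ (m, a, q) ∈ E ∧ (m', a, q') ∈ F := by
  simp only [prodEdges, List.mem_flatMap, Bool.cond_decide]
  constructor
  · rintro ⟨⟨x, c, y⟩, he, ⟨x', c', y'⟩, hf, h⟩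
    split_ifs at h with h1
    · simp only [List.mem_singleton, Prod.mk.injEq] at h h1
      obtain ⟨⟨rfl, rfl⟩, rfl, rfl, rfl⟩ := h
      subst h1
      exact ⟨he, hf⟩
    · simp at h
  · rintro ⟨he, hf⟩
    exact ⟨_, he, _, hf, by simp⟩

theorem reach_prodEdges {F : List (Edge r V')} {b q : V} {b' q' : V'} {w : Word r} :
    Reach (prodEdges E F) (b, b') w (q, q') ↔ Reach E b w q ∧ Reach F b' w q' := by
  induction w generalizing q q' with
  | nil => simp [Reach]
  | cons a w ih =>
    simp only [Reach, Prod.exists, ih, mem_prodEdges]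
    constructor
    · rintro ⟨m, m', ⟨h1, h2⟩, h3, h4⟩
      exact ⟨⟨m, h1, h3⟩, ⟨m', h2, h4⟩⟩
    · rintro ⟨⟨m, h1, h3⟩, ⟨m', h2, h4⟩⟩
      exact ⟨m, m', ⟨h1, h2⟩, h3, h4⟩

end Reach

/-! ### Shortest reduced words leading to the vertices of a graph -/

section explore

variable {r : ℕ} {V : Type}

theorem isReduced_cons_iff {a : Letter r} {w : Word r} :
    IsReduced (a :: w) ↔ w.head? ≠ some a.inv ∧ IsReduced w := by
  cases w with
  | nil => simp
  | cons b w =>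
    obtain ⟨i, x⟩ := a
    obtain ⟨j, y⟩ := b
    rw [isReduced_cons_cons]
    refine and_congr ?_ Iff.rfl
    simp only [List.head?_cons, Letter.inv, ne_eq, Option.some.injEq, Prod.mk.injEq, not_and]
    cases x <;> cases y <;> simp [eq_comm]

variable {E : List (Edge r V)} {b : V}

/-- A walk without backtracking as the list of its edges, the last edge first. -/
def IsTrace (E : List (Edge r V)) (b : V) : List (Edge r V) → Prop
  | [] => True
  | e :: l => e ∈ E ∧ ((l.head?.map fun f => f.2.2).getD b) = e.1 ∧
      (l.head?.map fun f => f.2.1) ≠ some (Letter.inv e.2.1) ∧ IsTrace E b l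

theorem IsTrace.of_suffix {l m : List (Edge r V)} (h : IsTrace E b m) (hl : l <:+ m) :
    IsTrace E b l := by
  induction m with
  | nil => rw [List.suffix_nil.1 hl]; trivial
  | cons e m ih =>
    rcases List.suffix_cons_iff.1 hl with rfl | hl
    · exact h
    · exact ih h.2.2.2 hl

/-- Cut out the stretch between two passages of the same edge. What may follow depends only on the
last edge, so no backtracking is created. Cutting at repeated vertices could create it, which is why
edges are counted. -/
theorem IsTrace.exists_nodup {l : List (Edge r V)} (h : IsTrace E b l) :
    ∃ m, IsTrace E b m ∧ m.head? = l.head? ∧ m.length ≤ l.length ∧ m.Nodup := by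
  induction l with
  | nil => exact ⟨[], trivial, rfl, le_rfl, List.nodup_nil⟩
  | cons e l ih =>
    obtain ⟨h1, h2, h3, h4⟩ := h
    obtain ⟨m, hm, hm1, hm2, hm3⟩ := ih h4
    by_cases he : e ∈ m
    · obtain ⟨x, z, rfl⟩ := List.append_of_mem he
      have hs : e :: z <:+ x ++ e :: z := List.suffix_append _ _
      refine ⟨e :: z, hm.of_suffix hs, rfl, ?_, hm3.sublist hs.sublist⟩
      simp only [List.length_append, List.length_cons] at hm2 ⊢
      omega
    · exact ⟨e :: m, ⟨h1, by rwa [hm1], by rwa [hm1], hm⟩, rfl, by simpa using hm2,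
        List.nodup_cons.2 ⟨he, hm3⟩⟩

theorem IsTrace.subset {l : List (Edge r V)} (h : IsTrace E b l) : l ⊆ E := by
  induction l with
  | nil => simp
  | cons e l ih => exact List.cons_subset.2 ⟨h.1, ih h.2.2.2⟩

theorem IsTrace.reach {l : List (Edge r V)} (h : IsTrace E b l) :
    Reach E b (l.map fun e => e.2.1) ((l.head?.map fun f => f.2.2).getD b) ∧
      IsReduced (l.map fun e => e.2.1) := by
  induction l with
  | nil => exact ⟨rfl, IsReduced.nil⟩
  | cons e l ih =>
    obtain ⟨h1, h2, h3, h4⟩ := h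
    obtain ⟨h5, h6⟩ := ih h4
    rw [h2] at h5
    refine ⟨⟨_, h5, h1⟩, isReduced_cons_iff.2 ⟨?_, h6⟩⟩
    simpa [List.head?_map] using h3

theorem exists_isTrace {q : V} {w : Word r} (h : Reach E b w q) (hw : IsReduced w) :
    ∃ l, IsTrace E b l ∧ (l.map fun e => e.2.1) = w ∧
      (l.head?.map fun f => f.2.2).getD b = q := by
  induction w generalizing q with
  | nil => exact ⟨[], trivial, rfl, (show q = b from h).symm⟩
  | cons a w ih =>
    obtain ⟨m, h1, h2⟩ := h
    obtain ⟨h3, h4⟩ := isReduced_cons_iff.1 hw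
    obtain ⟨l, hl, hl1, hl2⟩ := ih h1 h4
    refine ⟨(m, a, q) :: l, ⟨h2, hl2, ?_, hl⟩, by simp [hl1], rfl⟩
    rw [← hl1, List.head?_map] at h3
    exact h3

variable [DecidableEq V]

/-- The words of the previous layer, prolonged by one edge: one word for each last edge. -/
def nextLayer (E : List (Edge r V)) (T : List (V × Word r)) : List (V × Word r) :=
  E.flatMap fun e =>
    headElim (T.filter fun t => decide (t.1 = e.1) && !decide (t.2.head? = some (Letter.inv e.2.1)))
      [] fun t => [(e.2.2, e.2.1 :: t.2)]

/-- The layer of words of length `n`. -/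
def layer (E : List (Edge r V)) (b : V) : ℕ → List (V × Word r)
  | 0 => [(b, [])]
  | n + 1 => nextLayer E (layer E b n)

/-- All layers up to the number of edges. -/
def explore (E : List (Edge r V)) (b : V) : List (V × Word r) :=
  (E.foldl (fun (s : List (V × Word r) × List (V × Word r)) _ =>
    (s.1 ++ nextLayer E s.2, nextLayer E s.2)) ([(b, [])], [(b, [])])).1

theorem mem_nextLayer {T : List (V × Word r)} {q : V} {w : Word r} (h : (q, w) ∈ nextLayer E T) :
    ∃ m a v, w = a :: v ∧ (m, a, q) ∈ E ∧ (m, v) ∈ T ∧ v.head? ≠ some (Letter.inv a) := by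
  obtain ⟨⟨m, a, q'⟩, he, h⟩ := List.mem_flatMap.1 h
  dsimp only at h
  generalize hl : T.filter _ = l at h
  cases l with
  | nil => simp at h
  | cons t l =>
    have ht : t ∈ T.filter _ := hl ▸ List.mem_cons_self
    simp only [headElim_cons, List.mem_singleton, Prod.mk.injEq] at h
    obtain ⟨rfl, rfl⟩ := h
    obtain ⟨m', v⟩ := t
    simp only [List.mem_filter, Bool.and_eq_true, decide_eq_true_eq, Bool.not_eq_eq_eq_not,
      Bool.not_true, decide_eq_false_iff_not] at ht
    obtain ⟨h1, rfl, h2⟩ := ht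
    exact ⟨_, _, _, rfl, he, h1, h2⟩

theorem exists_mem_nextLayer {T : List (V × Word r)} {m q : V} {a : Letter r} {v : Word r}
    (he : (m, a, q) ∈ E) (hv : (m, v) ∈ T) (ha : v.head? ≠ some a.inv) :
    ∃ v', (q, a :: v') ∈ nextLayer E T := by
  have hmem : (m, v) ∈ T.filter fun t =>
      decide (t.1 = m) && !decide (t.2.head? = some (Letter.inv a)) := by
    simp [hv, ha]
  obtain ⟨t, l, hl⟩ := List.exists_cons_of_ne_nil (List.ne_nil_of_mem hmem)
  refine ⟨t.2, List.mem_flatMap.2 ⟨_, he, ?_⟩⟩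
  dsimp only
  rw [hl]
  simp

theorem length_nextLayer_le (E : List (Edge r V)) (T : List (V × Word r)) :
    (nextLayer E T).length ≤ E.length := by
  rw [nextLayer]
  induction E with
  | nil => simp
  | cons e E ih =>
    rw [List.flatMap_cons, List.length_append, List.length_cons]
    have : ∀ l : List (V × Word r),
        (headElim l [] fun t => [(e.2.2, e.2.1 :: t.2)]).length ≤ 1 := by
      intro l
      cases l <;> simp
    have := this (T.filter fun t =>
      decide (t.1 = e.1) && !decide (t.2.head? = some (Letter.inv e.2.1)))
    omega

theorem length_layer_le (E : List (Edge r V)) (b : V) (n : ℕ) :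
    (layer E b n).length ≤ E.length + 1 := by
  cases n with
  | zero => simp [layer]
  | succ n => exact (length_nextLayer_le _ _).trans (Nat.le_succ _)

theorem layer_sound {n : ℕ} {q : V} {w : Word r} (h : (q, w) ∈ layer E b n) :
    Reach E b w q ∧ IsReduced w ∧ w.length = n := by
  induction n generalizing q w with
  | zero =>
    simp only [layer, List.mem_singleton, Prod.mk.injEq] at h
    obtain ⟨rfl, rfl⟩ := h
    exact ⟨rfl, IsReduced.nil, rfl⟩
  | succ n ih =>
    obtain ⟨m, a, v, rfl, he, hv, ha⟩ := mem_nextLayer h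
    obtain ⟨h1, h2, h3⟩ := ih hv
    exact ⟨⟨m, h1, he⟩, isReduced_cons_iff.2 ⟨ha, h2⟩, by simp [h3]⟩

/-- The word kept in the layer may differ from `w`, but its endpoint and head letter agree, and
these alone decide which prolongations stay reduced. -/
theorem layer_complete {q : V} {w : Word r} (h : Reach E b w q) (hw : IsReduced w) :
    ∃ w', (q, w') ∈ layer E b w.length ∧ w'.head? = w.head? := by
  induction w generalizing q with
  | nil => exact ⟨[], by simp [layer, show q = b from h], rfl⟩
  | cons a w ih =>
    obtain ⟨m, h1, h2⟩ := h
    obtain ⟨h3, h4⟩ := isReduced_cons_iff.1 hw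
    obtain ⟨v, hv, hv'⟩ := ih h1 h4
    obtain ⟨v', hv''⟩ := exists_mem_nextLayer h2 hv (hv' ▸ h3)
    exact ⟨_, hv'', rfl⟩

/-- The entries of `l` serve only to count rounds. -/
theorem explore_foldl (l : List (Edge r V)) :
    l.foldl (fun (s : List (V × Word r) × List (V × Word r)) _ =>
      (s.1 ++ nextLayer E s.2, nextLayer E s.2)) ([(b, [])], [(b, [])]) =
    ((List.range (l.length + 1)).flatMap (layer E b), layer E b l.length) := by
  induction l using List.reverseRecOn with
  | nil => simp [layer]
  | append_singleton l e ih =>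
    rw [List.foldl_append, ih]
    simp [List.range_succ (n := l.length + 1), layer]

theorem explore_eq : explore E b = (List.range (E.length + 1)).flatMap (layer E b) := by
  rw [explore, explore_foldl]

theorem explore_sound {q : V} {w : Word r} (h : (q, w) ∈ explore E b) :
    Reach E b w q ∧ IsReduced w := by
  rw [explore_eq, List.mem_flatMap] at h
  obtain ⟨n, -, h⟩ := h
  exact ⟨(layer_sound h).1, (layer_sound h).2.1⟩

/-- A trace without repeated edges is no longer than the edge list, so its layer is among those
computed. The head letter is preserved because the search compares first letters. -/
theorem explore_complete {q : V} {w : Word r} (h : Reach E b w q) (hw : IsReduced w) :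
    ∃ w', (q, w') ∈ explore E b ∧ w'.length ≤ w.length ∧ w'.head? = w.head? := by
  obtain ⟨l, hl, rfl, hl2⟩ := exists_isTrace h hw
  obtain ⟨m, hm, hm1, hm2, hm3⟩ := hl.exists_nodup
  have hlen : m.length ≤ E.length := (List.subperm_of_subset hm3 hm.subset).length_le
  obtain ⟨h1, h2⟩ := hm.reach
  rw [hm1, hl2] at h1
  obtain ⟨w', h3, h4⟩ := layer_complete h1 h2
  rw [List.length_map] at h3
  refine ⟨w', ?_, ?_, ?_⟩
  · rw [explore_eq, List.mem_flatMap]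
    exact ⟨m.length, List.mem_range.2 (by omega), h3⟩
  · rw [(layer_sound h3).2.2]
    simpa using hm2
  · rw [h4, List.head?_map, List.head?_map, hm1]

end explore

end SubgroupDistance

/-! ### Stallings foldings -/

namespace SubgroupDistance

open TreeWhile FreeGroup

section fold

variable {r : ℕ} {V : Type} [DecidableEq V]

/-- The map that sends `x` to `y` and fixes everything else. -/
def rename (x y v : V) : V := bif decide (v = x) then y else v

/-- Identification of the vertex `x` with `y`. -/
def renameEdges (x y : V) (E : List (Edge r V)) : List (Edge r V) :=
  E.map fun e => (rename x y e.1, e.2.1, rename x y e.2.2)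

/-- The pairs of distinct targets of edges with the same source and label. -/
def conflicts (E : List (Edge r V)) : List (V × V) :=
  E.flatMap fun e => E.flatMap fun f =>
    bif decide (e.1 = f.1) && (decide (e.2.1 = f.2.1) && !decide (e.2.2 = f.2.2))
    then [(e.2.2, f.2.2)] else []

/-- One folding of a graph with base point. -/
def foldStep (s : V × List (Edge r V)) : V × List (Edge r V) :=
  headElim (conflicts s.2) s fun c => (rename c.2 c.1 s.1, renameEdges c.2 c.1 s.2)

/-- Repeated folding, once for each edge. -/
def foldGraph (s : V × List (Edge r V)) : V × List (Edge r V) :=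
  s.2.foldl (fun s _ => foldStep s) s

theorem mem_conflicts {E : List (Edge r V)} {x y : V} :
    (x, y) ∈ conflicts E ↔ x ≠ y ∧ ∃ m a, (m, a, x) ∈ E ∧ (m, a, y) ∈ E := by
  simp only [conflicts, List.mem_flatMap]
  constructor
  · rintro ⟨⟨m, a, x'⟩, he, ⟨m', a', y'⟩, hf, h⟩
    rw [Bool.cond_eq_ite] at h
    split_ifs at h with h1
    · simp only [Bool.and_eq_true, decide_eq_true_eq, Bool.not_eq_eq_eq_not, Bool.not_true,
        decide_eq_false_iff_not] at h1
      simp only [List.mem_singleton, Prod.mk.injEq] at h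
      obtain ⟨rfl, rfl⟩ := h
      obtain ⟨rfl, rfl, h1⟩ := h1
      exact ⟨h1, _, _, he, hf⟩
    · simp at h
  · rintro ⟨h, m, a, he, hf⟩
    exact ⟨_, he, _, hf, by simp [h]⟩

theorem deterministic_of_conflicts_eq_nil {E : List (Edge r V)} (h : conflicts E = []) :
    Deterministic E := by
  intro m a q q' h1 h2
  by_contra hne
  have : (q, q') ∈ conflicts E := mem_conflicts.2 ⟨hne, m, a, h1, h2⟩
  simp [h] at this

/-- The targets of the edges. -/
def targets (E : List (Edge r V)) : Finset V := (E.map fun e => e.2.2).toFinset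

theorem mem_targets {E : List (Edge r V)} {m q : V} {a : Letter r} (h : (m, a, q) ∈ E) :
    q ∈ targets E := by
  simp only [targets, List.mem_toFinset, List.mem_map]
  exact ⟨_, h, rfl⟩

/-- The name `y` disappears, and its replacement `x` was a target before. -/
theorem card_targets_renameEdges_lt {E : List (Edge r V)} {x y : V} (hxy : x ≠ y)
    (hx : x ∈ targets E) (hy : y ∈ targets E) :
    (targets (renameEdges y x E)).card < (targets E).card := by
  refine (Finset.card_le_card (t := (targets E).erase y) ?_).trans_lt
    (Finset.card_erase_lt_of_mem hy)
  intro v hv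
  simp only [targets, renameEdges, List.mem_toFinset, List.mem_map, List.map_map] at hv
  obtain ⟨⟨m, a, q⟩, he, rfl⟩ := hv
  simp only [Function.comp, rename, Bool.cond_decide]
  split_ifs with h
  · exact Finset.mem_erase.2 ⟨hxy, hx⟩
  · exact Finset.mem_erase.2 ⟨h, mem_targets he⟩

/-- A property that is kept by all foldings is kept by repeated folding. -/
theorem foldGraph_induction (P : V × List (Edge r V) → Prop)
    (hP : ∀ s x y, (x, y) ∈ conflicts s.2 → P s → P (rename y x s.1, renameEdges y x s.2))
    {s : V × List (Edge r V)} (hs : P s) (l : List (Edge r V)) :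
    P (l.foldl (fun s _ => foldStep s) s) := by
  have step : ∀ s, P s → P (foldStep s) := by
    intro s hs
    rw [foldStep]
    generalize hc : conflicts s.2 = c
    cases c with
    | nil => exact hs
    | cons c l =>
      rw [headElim_cons]
      exact hP s c.1 c.2 (hc ▸ List.mem_cons_self) hs
  induction l generalizing s with
  | nil => exact hs
  | cons e l ih => exact ih (step s hs)

theorem foldGraph_deterministic (s : V × List (Edge r V)) : Deterministic (foldGraph s).2 := by
  -- Until no conflict is left, every round loses at least one target. There are at most as many
  -- targets as edges, so surviving conflicts after all rounds would leave no target, hence no edge.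
  have key : ∀ l : List (Edge r V), conflicts (l.foldl (fun s _ => foldStep s) s).2 = [] ∨
      (targets (l.foldl (fun s _ => foldStep s) s).2).card + l.length ≤ (targets s.2).card := by
    intro l
    induction l using List.reverseRecOn with
    | nil => right; simp
    | append_singleton l e ih =>
      rw [List.foldl_append, List.foldl_cons, List.foldl_nil, List.length_append,
        List.length_singleton]
      generalize l.foldl (fun s _ => foldStep s) s = s' at ih ⊢
      rw [foldStep]
      generalize hc : conflicts s'.2 = c
      cases c with
      | nil => left; rw [headElim_nil, hc]
      | cons c k =>
        right
        have hmem : (c.1, c.2) ∈ conflicts s'.2 := hc ▸ List.mem_cons_self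
        obtain ⟨h1, m, a, h2, h3⟩ := mem_conflicts.1 hmem
        have := card_targets_renameEdges_lt h1 (mem_targets h2) (mem_targets h3)
        rw [hc] at ih
        simp only [reduceCtorEq, false_or] at ih
        simp only [headElim_cons]
        omega
  apply deterministic_of_conflicts_eq_nil
  rcases key s.2 with h | h
  · exact h
  · have h1 : (targets s.2).card ≤ s.2.length := by
      simpa [targets] using List.toFinset_card_le (s.2.map fun e => e.2.2)
    have h2 : (targets (foldGraph s).2).card = 0 := by
      rw [foldGraph]; omega
    have h3 : (foldGraph s).2 = [] := by
      rw [Finset.card_eq_zero, targets, List.toFinset_eq_empty_iff, List.map_eq_nil_iff] at h2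
      exact h2
    rw [h3]
    rfl

theorem Symm.renameEdges {E : List (Edge r V)} (h : Symm E) (x y : V) :
    Symm (renameEdges x y E) := by
  intro m a q hm
  obtain ⟨⟨m', a', q'⟩, he, heq⟩ := List.mem_map.1 hm
  simp only [Prod.mk.injEq] at heq
  obtain ⟨rfl, rfl, rfl⟩ := heq
  exact List.mem_map.2 ⟨_, h _ _ _ he, rfl⟩

end fold

/-! ### The Stallings graph and the cosets of the subgroup. -/

section cosets

variable {r : ℕ} {H : Subgroup (FreeGroup (Fin r))}

/-- Every vertex `v` stands for the coset `vH`, and edges act by multiplication from the left. -/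
def Compatible (H : Subgroup (FreeGroup (Fin r))) (E : List (Edge r (Word r))) : Prop :=
  ∀ m a q, (m, a, q) ∈ E → (mk q)⁻¹ * mk (a :: m) ∈ H

theorem mk_cons_eq (a : Letter r) (w : Word r) : mk (a :: w) = mk [a] * mk w := by
  rw [mul_mk, List.singleton_append]

theorem Compatible.mem_of_reach {E : List (Edge r (Word r))} (h : Compatible H E) {b q w : Word r}
    (hb : mk b ∈ H) (hw : Reach E b w q) : (mk q)⁻¹ * mk w ∈ H := by
  induction w generalizing q with
  | nil =>
    rw [show q = b from hw, ← one_eq_mk, mul_one]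
    exact H.inv_mem hb
  | cons a w ih =>
    obtain ⟨m, h1, h2⟩ := hw
    have := H.mul_mem (h _ _ _ h2) (ih h1)
    rwa [mk_cons_eq, mul_assoc, mul_assoc, mul_inv_cancel_left, ← mk_cons_eq] at this

theorem Compatible.renameEdges {E : List (Edge r (Word r))} (h : Compatible H E) {x y : Word r}
    (hxy : (mk y)⁻¹ * mk x ∈ H) : Compatible H (renameEdges x y E) := by
  have hσ : ∀ v, (mk (rename x y v))⁻¹ * mk v ∈ H := by
    intro v
    simp only [rename, Bool.cond_decide]
    split_ifs with hv
    · rwa [hv]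
    · rw [inv_mul_cancel]; exact one_mem _
  intro m a q hm
  obtain ⟨⟨m', a', q'⟩, he, heq⟩ := List.mem_map.1 hm
  simp only [Prod.mk.injEq] at heq
  obtain ⟨rfl, rfl, rfl⟩ := heq
  have := H.mul_mem (H.mul_mem (hσ q') (h _ _ _ he)) (H.inv_mem (hσ m'))
  rw [mk_cons_eq] at this ⊢
  simpa [mul_assoc, -mul_mk, -inv_mk] using this

/-- The edges of the walk labelled by a word. -/
def pathEdges : Word r → List (Edge r (Word r))
  | [] => []
  | a :: w => (w, a, a :: w) :: pathEdges w

theorem reach_pathEdges (w : Word r) : Reach (pathEdges w) [] w w := by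
  induction w with
  | nil => rfl
  | cons a w ih =>
    exact ⟨w, ih.mono (List.subset_cons_self _ _), List.mem_cons_self⟩

theorem compatible_pathEdges (w : Word r) : Compatible H (pathEdges w) := by
  induction w with
  | nil => intro m a q h; simp [pathEdges] at h
  | cons b w ih =>
    intro m a q h
    rcases List.mem_cons.1 h with h | h
    · simp only [Prod.mk.injEq] at h
      obtain ⟨rfl, rfl, rfl⟩ := h
      rw [inv_mul_cancel]; exact one_mem _
    · exact ih m a q h

/-- The loops labelled by the given words. -/
def loopEdges (L : List (Word r)) : List (Edge r (Word r)) :=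
  L.flatMap fun u => renameEdges u [] (pathEdges u)

/-- The loops labelled by the given words, with all reverse edges. -/
def roseEdges (L : List (Word r)) : List (Edge r (Word r)) :=
  loopEdges L ++ (loopEdges L).map Edge.flip

theorem mk_mem_subgroupOf {L : List (Word r)} {u : Word r} (h : u ∈ L) : mk u ∈ subgroupOf L :=
  Subgroup.subset_closure ⟨u, h, rfl⟩

/-- Vertices are suffixes of the generators, so loops of different generators may share vertices.
This is harmless, since a vertex always stands for its own coset. Closing a loop merges `u` with the
empty word, and both stand for the trivial coset. -/
theorem compatible_roseEdges (L : List (Word r)) : Compatible (subgroupOf L) (roseEdges L) := by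
  have key : Compatible (subgroupOf L) (loopEdges L) := by
    intro m a q h
    obtain ⟨u, hu, h⟩ := List.mem_flatMap.1 h
    refine (compatible_pathEdges u).renameEdges ?_ m a q h
    simpa [← one_eq_mk] using mk_mem_subgroupOf hu
  intro m a q h
  rcases List.mem_append.1 h with h | h
  · exact key m a q h
  · obtain ⟨⟨m', a', q'⟩, he, heq⟩ := List.mem_map.1 h
    simp only [Edge.flip, Prod.mk.injEq] at heq
    obtain ⟨rfl, rfl, rfl⟩ := heq
    have h1 := (subgroupOf L).inv_mem (key _ _ _ he)
    have h2 : mk [Letter.inv a'] = (mk [a'])⁻¹ := by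
      rw [inv_mk]; rfl
    rw [mk_cons_eq] at h1 ⊢
    rw [h2]
    simpa [mul_assoc, -mul_mk, -inv_mk] using h1

theorem symm_roseEdges (L : List (Word r)) : Symm (roseEdges L) := by
  intro m a q h
  rcases List.mem_append.1 h with h | h
  · exact List.mem_append_right _ (List.mem_map.2 ⟨_, h, rfl⟩)
  · obtain ⟨⟨m', a', q'⟩, he, heq⟩ := List.mem_map.1 h
    simp only [Edge.flip, Prod.mk.injEq] at heq
    obtain ⟨rfl, rfl, rfl⟩ := heq
    rw [Letter.inv_inv]
    exact List.mem_append_left _ he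

theorem reach_roseEdges {L : List (Word r)} {u : Word r} (h : u ∈ L) :
    Reach (roseEdges L) [] u [] := by
  have h1 := (reach_pathEdges u).map (rename u [])
  have h2 : rename u [] u = [] := by simp [rename]
  have h3 : rename u [] ([] : Word r) = [] := by simp [rename]
  rw [h2, h3] at h1
  refine h1.mono fun e he => List.mem_append_left _ ?_
  exact List.mem_flatMap.2 ⟨u, h, he⟩

/-- The folded graph of the subgroup generated by the given words, with its base point. -/
def stallings (L : List (Word r)) : Word r × List (Edge r (Word r)) :=
  foldGraph ([], roseEdges L)

theorem stallings_deterministic (L : List (Word r)) : Deterministic (stallings L).2 :=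
  foldGraph_deterministic _

/-- All four properties survive a fold. The two merged vertices are reached from one vertex by one
letter, so they stand for the same coset, and renaming is a graph map that carries walks to walks.
-/
theorem stallings_spec (L : List (Word r)) :
    Compatible (subgroupOf L) (stallings L).2 ∧ mk (stallings L).1 ∈ subgroupOf L ∧
      Symm (stallings L).2 ∧
      ∀ u ∈ L, Reach (stallings L).2 (stallings L).1 u (stallings L).1 := by
  refine foldGraph_induction (fun s => Compatible (subgroupOf L) s.2 ∧ mk s.1 ∈ subgroupOf L ∧
    Symm s.2 ∧ ∀ u ∈ L, Reach s.2 s.1 u s.1) ?_ ⟨compatible_roseEdges L, ?_, symm_roseEdges L,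
      fun u hu => reach_roseEdges hu⟩ _
  · rintro ⟨b, E⟩ x y hxy ⟨h1, h2, h3, h4⟩
    obtain ⟨-, m, a, hx, hy⟩ := mem_conflicts.1 hxy
    have h5 : (mk x)⁻¹ * mk y ∈ subgroupOf L := by
      simpa [mul_assoc, -mul_mk, -inv_mk] using
        (subgroupOf L).mul_mem (h1 _ _ _ hx) ((subgroupOf L).inv_mem (h1 _ _ _ hy))
    refine ⟨h1.renameEdges h5, ?_, h3.renameEdges _ _, fun u hu => (h4 u hu).map (rename y x)⟩
    simp only [rename, Bool.cond_decide]
    split_ifs with hb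
    · have := (subgroupOf L).mul_mem h2 ((subgroupOf L).inv_mem h5)
      simpa [hb, -mul_mk, -inv_mk] using this
    · exact h2
  · rw [← one_eq_mk]
    exact one_mem _

/-- Closed walks can be concatenated and reversed, so every element has some word labelling one.
Free reduction keeps it closed in the folded graph. -/
theorem reach_toWord_of_mem {L : List (Word r)} {g : FreeGroup (Fin r)} (hg : g ∈ subgroupOf L) :
    Reach (stallings L).2 (stallings L).1 g.toWord (stallings L).1 := by
  obtain ⟨-, -, h3, h4⟩ := stallings_spec L
  suffices h : ∃ w, mk w = g ∧ Reach (stallings L).2 (stallings L).1 w (stallings L).1 by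
    obtain ⟨w, rfl, hw⟩ := h
    exact hw.reduce (stallings_deterministic L) h3
  induction hg using Subgroup.closure_induction with
  | mem x hx =>
    obtain ⟨w, hw, rfl⟩ := hx
    exact ⟨w, rfl, h4 w hw⟩
  | one => exact ⟨[], rfl, rfl⟩
  | mul x y _ _ hx hy =>
    obtain ⟨v, rfl, hv⟩ := hx
    obtain ⟨w, rfl, hw⟩ := hy
    exact ⟨v ++ w, rfl, reach_append.2 ⟨_, hw, hv⟩⟩
  | inv x _ hx =>
    obtain ⟨v, rfl, hv⟩ := hx
    exact ⟨invRev v, rfl, hv.invRev h3⟩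

theorem mem_of_reach_stallings {L : List (Word r)} {q z w : Word r}
    (hz : Reach (stallings L).2 (stallings L).1 z q)
    (hw : Reach (stallings L).2 (stallings L).1 w q) : mk (invRev z ++ w) ∈ subgroupOf L := by
  obtain ⟨h1, h2, -, -⟩ := stallings_spec L
  have := (subgroupOf L).mul_mem ((subgroupOf L).inv_mem (h1.mem_of_reach h2 hz))
    (h1.mem_of_reach h2 hw)
  rw [← mul_mk, ← inv_mk]
  simpa [mul_assoc, -mul_mk, -inv_mk] using this

end cosets

end SubgroupDistance

/-! ### The search for a closest pair -/

namespace SubgroupDistance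

open TreeWhile FreeGroup

section search

variable {r : ℕ}

/-- The pairs of elements found from the words leading to the vertices of two graphs and of their
product, each with a word whose length bounds the distance. -/
def candidates {V V' : Type} [DecidableEq V] [DecidableEq V'] (T₁ : List (V × Word r))
    (T₂ : List (V' × Word r)) (T₃ : List ((V × V') × Word r)) :
    List ((Word r × Word r) × Word r) :=
  T₃.flatMap fun z => T₁.flatMap fun x => T₂.flatMap fun y =>
    bif decide (z.1 = (x.1, y.1)) && !decide (x.2.head? = y.2.head?)
    then [((invRev z.2 ++ x.2, invRev z.2 ++ y.2), x.2 ++ y.2)] else []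

/-- The word `w` without its first `v.length` letters. -/
def dropLength (v w : Word r) : Word r := v.foldl (fun x _ => x.tail) w

theorem dropLength_eq (v w : Word r) : dropLength v w = w.drop v.length := by
  rw [dropLength]
  induction v generalizing w with
  | nil => rfl
  | cons a v ih => rw [List.foldl_cons, ih, List.length_cons, ← List.drop_one, List.drop_drop,
      add_comm]

/-- A candidate with the shortest last component, as a list of at most one entry. -/
def shortest {α : Type} (l : List (α × Word r)) : List (α × Word r) :=
  l.foldl (fun acc c =>
    headElim acc [c] fun a => bif (dropLength a.2 c.2).isEmpty then [c] else [a]) []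

theorem shortest_spec {α : Type} (l : List (α × Word r)) :
    (l = [] ∧ shortest l = []) ∨
      ∃ c ∈ l, shortest l = [c] ∧ ∀ d ∈ l, c.2.length ≤ d.2.length := by
  induction l using List.reverseRecOn with
  | nil => left; exact ⟨rfl, rfl⟩
  | append_singleton l c ih =>
    right
    have hs : shortest (l ++ [c]) = headElim (shortest l) [c]
        fun a => bif (dropLength a.2 c.2).isEmpty then [c] else [a] := by
      simp [shortest]
    rcases ih with ⟨rfl, h⟩ | ⟨a, ha, h, hmin⟩
    · exact ⟨c, by simp, by rw [hs, h]; rfl, by simp⟩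
    -- Nothing remains of the new word exactly when it is no longer than the current minimum.
    · rw [h, headElim_cons, dropLength_eq, Bool.cond_eq_ite] at hs
      simp only [List.isEmpty_iff, List.drop_eq_nil_iff] at hs
      split_ifs at hs with hle
      · refine ⟨c, by simp, hs, fun d hd => ?_⟩
        rcases List.mem_append.1 hd with hd | hd
        · exact hle.trans (hmin d hd)
        · rw [List.mem_singleton.1 hd]
      · refine ⟨a, by simp [ha], hs, fun d hd => ?_⟩
        rcases List.mem_append.1 hd with hd | hd
        · exact hmin d hd
        · rw [List.mem_singleton.1 hd]; omega

/-- The closest pair for two graphs with base points. -/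
def closest {V V' : Type} [DecidableEq V] [DecidableEq V'] (G : V × List (Edge r V))
    (K : V' × List (Edge r V')) : Option (Word r × Word r) :=
  headElim
    ((explore (prodEdges G.2 K.2) (G.1, K.1)).filter fun t =>
      decide (t.1 = (G.1, K.1)) && !t.2.isEmpty)
    (headElim (shortest (candidates (explore G.2 G.1) (explore K.2 K.1)
      (explore (prodEdges G.2 K.2) (G.1, K.1)))) none fun c => some c.1)
    fun t => some (t.2, t.2)

/-- The algorithm on words. -/
def solve (L M : List (Word r)) : Option (Word r × Word r) := closest (stallings L) (stallings M)

theorem exists_common_prefix {α : Type} {x y : List α} (h : x ≠ y) :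
    ∃ u v w, x = u ++ v ∧ y = u ++ w ∧ v.head? ≠ w.head? := by
  classical
  induction x generalizing y with
  | nil =>
    cases y with
    | nil => exact absurd rfl h
    | cons b y => exact ⟨[], [], b :: y, rfl, rfl, by simp⟩
  | cons a x ih =>
    cases y with
    | nil => exact ⟨[], a :: x, [], rfl, rfl, by simp⟩
    | cons b y =>
      by_cases hab : a = b
      · subst hab
        obtain ⟨u, v, w, rfl, rfl, h'⟩ := ih (y := y) (fun h' => h (by rw [h']))
        exact ⟨a :: u, v, w, rfl, rfl, h'⟩
      · exact ⟨[], a :: x, b :: y, rfl, rfl, by simpa using hab⟩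

theorem isReduced_invRev {w : Word r} (h : IsReduced w) : IsReduced (invRev w) := by
  rw [isReduced_iff_reduce_eq] at h ⊢
  rw [reduce_invRev, h]

/-- The only possible cancellation is at the junction, where the inverse of the first letter of `v`
meets the first letter of `w`. -/
theorem isReduced_invRev_append {v w : Word r} (hv : IsReduced v) (hw : IsReduced w)
    (h : v.head? ≠ w.head?) : IsReduced (invRev v ++ w) := by
  refine List.isChain_append.2 ⟨isReduced_invRev hv, hw, ?_⟩
  rintro ⟨i, x⟩ hx ⟨j, y⟩ hy
  cases v with
  | nil => simp at hx
  | cons a v =>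
    cases w with
    | nil => simp at hy
    | cons b w =>
      obtain ⟨i', x'⟩ := a
      obtain ⟨j', y'⟩ := b
      simp only [FreeGroup.invRev, List.map_cons, List.reverse_cons, List.getLast?_append,
        List.getLast?_singleton, Option.some_or, Option.mem_def, Option.some.injEq, Prod.mk.injEq,
        List.head?_cons, ne_eq, not_and] at hx hy h
      obtain ⟨rfl, rfl⟩ := hx
      obtain ⟨rfl, rfl⟩ := hy
      intro hij
      have := h hij
      cases x' <;> cases y' <;> simp_all

theorem wordDist_eq {u v w : Word r} (hv : IsReduced v) (hw : IsReduced w)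
    (h : v.head? ≠ w.head?) : wordDist (mk (u ++ v)) (mk (u ++ w)) = v.length + w.length := by
  have h1 : (mk (u ++ v))⁻¹ * mk (u ++ w) = mk (invRev v ++ w) := by
    rw [← mul_mk, ← mul_mk, ← mul_mk, ← inv_mk, mul_inv_rev, mul_assoc, inv_mul_cancel_left]
  rw [wordDist, h1, wordLength_eq_norm, FreeGroup.norm, toWord_mk,
    (isReduced_invRev_append hv hw h).reduce_eq]
  simp

theorem eq_of_mk_eq {v w : Word r} (hv : IsReduced v) (hw : IsReduced w) (h : mk v = mk w) :
    v = w := by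
  have := congrArg toWord h
  rwa [toWord_mk, toWord_mk, hv.reduce_eq, hw.reduce_eq] at this

theorem mem_candidates {V V' : Type} [DecidableEq V] [DecidableEq V'] {T₁ : List (V × Word r)}
    {T₂ : List (V' × Word r)} {T₃ : List ((V × V') × Word r)}
    {c : (Word r × Word r) × Word r} :
    c ∈ candidates T₁ T₂ T₃ ↔ ∃ p q z v w, ((p, q), z) ∈ T₃ ∧ (p, v) ∈ T₁ ∧ (q, w) ∈ T₂ ∧
      v.head? ≠ w.head? ∧ c = ((invRev z ++ v, invRev z ++ w), v ++ w) := by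
  simp only [candidates, List.mem_flatMap]
  constructor
  · rintro ⟨⟨⟨p, q⟩, z⟩, hz, ⟨p', v⟩, hv, ⟨q', w⟩, hw, h⟩
    rw [Bool.cond_eq_ite] at h
    split_ifs at h with h1
    · simp only [Bool.and_eq_true, decide_eq_true_eq, Bool.not_eq_eq_eq_not, Bool.not_true,
        decide_eq_false_iff_not, Prod.mk.injEq] at h1
      obtain ⟨⟨rfl, rfl⟩, h1⟩ := h1
      exact ⟨_, _, _, _, _, hz, hv, hw, h1, List.mem_singleton.1 h⟩
    · simp at h
  · rintro ⟨p, q, z, v, w, hz, hv, hw, h, rfl⟩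
    exact ⟨_, hz, _, hv, _, hw, by simp [h]⟩

theorem solve_isAnswer (L M : List (Word r)) :
    IsAnswer (subgroupOf L) (subgroupOf M) (solve L M) := by
  set G := stallings L with hG
  set K := stallings M with hK
  set T₃ := explore (prodEdges G.2 K.2) (G.1, K.1) with hT₃
  set C := candidates (explore G.2 G.1) (explore K.2 K.1) T₃ with hC
  set I := T₃.filter fun t => decide (t.1 = (G.1, K.1)) && !t.2.isEmpty with hI
  have hsolve : solve L M = headElim I (headElim (shortest C) none fun c => some c.1)
      fun t => some (t.2, t.2) := rfl
  rw [hsolve]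
  cases hIc : I with
  -- A nonempty reduced word closed in the product is a nontrivial element of both subgroups, and
  -- taking it twice gives distance `0`.
  | cons t l =>
    rw [headElim_cons]
    have ht : t ∈ I := hIc ▸ List.mem_cons_self
    obtain ⟨v, z⟩ := t
    simp only [hI, List.mem_filter, Bool.and_eq_true, decide_eq_true_eq, Bool.not_eq_eq_eq_not,
      Bool.not_true, List.isEmpty_eq_false_iff] at ht
    obtain ⟨ht, rfl, hz⟩ := ht
    obtain ⟨h1, h2⟩ := explore_sound ht
    obtain ⟨h3, h4⟩ := reach_prodEdges.1 h1
    refine ⟨?_, ?_, ?_, ?_⟩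
    · simpa using mem_of_reach_stallings (z := []) rfl h3
    · simpa using mem_of_reach_stallings (z := []) rfl h4
    · rintro ⟨h5, -⟩
      exact hz (eq_of_mk_eq h2 IsReduced.nil h5)
    · intro h _ k _ _
      have : wordDist (mk z) (mk z) = 0 := by
        rw [wordDist, inv_mul_cancel, wordLength_eq_norm, FreeGroup.norm_one]
      rw [this]
      exact Nat.zero_le _
  | nil =>
    rw [headElim_nil]
    -- Lower bound: no admissible pair is closer than the best candidate.
    have hcand : ∀ h ∈ subgroupOf L, ∀ k ∈ subgroupOf M, ¬ (h = 1 ∧ k = 1) →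
        ∃ c ∈ C, c.2.length ≤ wordDist h k := by
      intro h hh k hk hne
      have hh' := reach_toWord_of_mem hh
      have hk' := reach_toWord_of_mem hk
      -- A common nontrivial element would be closed in the product. The exploration would then find
      -- a closed word with the same head letter, hence nonempty, against the emptiness of `I`.
      have hhk : h.toWord ≠ k.toWord := by
        intro heq
        rw [← heq] at hk'
        obtain ⟨z, h1, -, h2⟩ := explore_complete (reach_prodEdges.2 ⟨hh', hk'⟩) isReduced_toWord
        have h3 : ((G.1, K.1), z) ∈ I := by
          simp only [hI, List.mem_filter, Bool.and_eq_true, decide_eq_true_eq,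
            Bool.not_eq_eq_eq_not, Bool.not_true, List.isEmpty_eq_false_iff, true_and]
          refine ⟨h1, ?_⟩
          rintro rfl
          have h4 : h.toWord = [] := by simpa using h2.symm
          have h5 : k.toWord = [] := heq ▸ h4
          exact hne ⟨toWord_eq_nil_iff.1 h4, toWord_eq_nil_iff.1 h5⟩
        rw [hIc] at h3
        simp at h3
      obtain ⟨u, v, w, hv, hw, hvw⟩ := exists_common_prefix hhk
      have hrh : IsReduced (u ++ v) := hv ▸ isReduced_toWord
      have hrk : IsReduced (u ++ w) := hw ▸ isReduced_toWord
      have hru : IsReduced u := hrh.infix ⟨[], v, rfl⟩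
      have hrv : IsReduced v := hrh.infix ⟨u, [], by simp⟩
      have hrw : IsReduced w := hrk.infix ⟨u, [], by simp⟩
      rw [hv, reach_append] at hh'
      rw [hw, reach_append] at hk'
      obtain ⟨p, hp1, hp2⟩ := hh'
      obtain ⟨q, hq1, hq2⟩ := hk'
      -- The prefix `u` leads from `p` and from `q` back to the base points, so its inverse reaches
      -- `(p, q)`. The word `z` found instead may be another one, as only its endpoint matters.
      obtain ⟨z, hz, -, -⟩ := explore_complete (reach_prodEdges.2
        ⟨hp2.invRev (stallings_spec L).2.2.1, hq2.invRev (stallings_spec M).2.2.1⟩)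
        (isReduced_invRev hru)
      obtain ⟨v', hv1, hv2, hv3⟩ := explore_complete hp1 hrv
      obtain ⟨w', hw1, hw2, hw3⟩ := explore_complete hq1 hrw
      refine ⟨_, mem_candidates.2 ⟨p, q, z, v', w', hz, hv1, hw1, ?_, rfl⟩, ?_⟩
      · rwa [hv3, hw3]
      · have := wordDist_eq (u := u) hrv hrw hvw
        rw [← hv, ← hw, mk_toWord, mk_toWord] at this
        rw [this, List.length_append]
        omega
    rcases shortest_spec C with ⟨h1, h2⟩ | ⟨c, hc, h2, hmin⟩
    · rw [h2, headElim_nil]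
      intro h hh k hk
      by_contra hne
      obtain ⟨c, hc, -⟩ := hcand h hh k hk hne
      simp [h1] at hc
    · rw [h2, headElim_cons]
      obtain ⟨p, q, z, v, w, hz, hv, hw, hvw, rfl⟩ := mem_candidates.1 hc
      obtain ⟨hz1, hz2⟩ := explore_sound hz
      obtain ⟨hz3, hz4⟩ := reach_prodEdges.1 hz1
      obtain ⟨hv1, hv2⟩ := explore_sound hv
      obtain ⟨hw1, hw2⟩ := explore_sound hw
      refine ⟨mem_of_reach_stallings hz3 hv1, mem_of_reach_stallings hz4 hw1, ?_, ?_⟩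
      -- If both elements were trivial, the reduced words `v` and `w` would coincide, yet their
      -- first letters differ.
      · rintro ⟨h3, h4⟩
        have h5 := h3.trans h4.symm
        rw [← mul_mk, ← mul_mk, mul_right_inj] at h5
        exact hvw (by rw [eq_of_mk_eq hv2 hw2 h5])
      · intro h hh k hk hne
        obtain ⟨d, hd, hd'⟩ := hcand h hh k hk hne
        rw [wordDist_eq hv2 hw2 hvw]
        have := hmin d hd
        rw [List.length_append] at this
        omega

end search

end SubgroupDistance

/-! ### The algorithm runs in polynomial time -/

namespace TreeWhile

open Enc (enc)

instance {α : Type} [Enc α] : Enc (Option α) :=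
  ⟨fun o => o.elim .nil fun a => .cons (enc a) .nil, by
    intro a b h
    cases a <;> cases b <;> simp_all [Enc.enc_injective.eq_iff]⟩

namespace PolyTime

variable {α β : Type} [Enc α] [Enc β]

@[fun_prop]
theorem some {f : α → β} (hf : PolyTime f) : PolyTime (fun a => Option.some (f a)) :=
  (of_expr (fun k => .cons (.var k) .nil) (2 * Polynomial.X + 3) fun k s a hs => by
    refine ⟨by simp [Expr.eval, hs, enc], ?_⟩
    simp only [Expr.cost, Expr.eval, hs, Data.size, Polynomial.eval_add, Polynomial.eval_mul,
      Polynomial.eval_ofNat, Polynomial.eval_X]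
    change esize a + 1 + (esize a + 1 + 1) ≤ _
    omega : PolyTime (Option.some : β → Option β)).comp hf

@[fun_prop]
theorem head? {f : α → List β} (hf : PolyTime f) : PolyTime (fun a => (f a).head?) := by
  have h := PolyTime.headElim (h := fun _ b => Option.some b) hf (const none) (by fun_prop)
  have key : ∀ l : List β, TreeWhile.headElim l none (fun b => Option.some b) = l.head? :=
    fun l => by cases l <;> rfl
  simpa only [key] using h

end PolyTime

end TreeWhile

/-! ### Time and size bounds for folding, exploration and search. -/

namespace SubgroupDistance

open TreeWhile

variable {r : ℕ} {α V V' : Type} [Enc α] [Enc V] [Enc V']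

@[fun_prop]
theorem polyTime_inv {f : α → Letter r} (hf : PolyTime f) :
    PolyTime (fun a => Letter.inv (f a)) := by
  unfold Letter.inv
  fun_prop

@[fun_prop]
theorem polyTime_invRev {f : α → Word r} (hf : PolyTime f) :
    PolyTime (fun a => FreeGroup.invRev (f a)) := by
  unfold FreeGroup.invRev
  exact (PolyTime.map (g := fun _ (b : Letter r) => (b.1, !b.2)) hf (by fun_prop)).reverse

@[fun_prop]
theorem polyTime_prodEdges {E : α → List (Edge r V)} {F : α → List (Edge r V')}
    (hE : PolyTime E) (hF : PolyTime F) : PolyTime (fun a => prodEdges (E a) (F a)) := by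
  unfold prodEdges
  refine PolyTime.flatMap hE (PolyTime.flatMap (by fun_prop) ?_)
  fun_prop

variable [DecidableEq V] [DecidableEq V']

@[fun_prop]
theorem polyTime_rename {x y v : α → V} (hx : PolyTime x) (hy : PolyTime y) (hv : PolyTime v) :
    PolyTime (fun a => rename (x a) (y a) (v a)) := by
  unfold rename
  fun_prop

@[fun_prop]
theorem polyTime_renameEdges {x y : α → V} {E : α → List (Edge r V)} (hx : PolyTime x)
    (hy : PolyTime y) (hE : PolyTime E) :
    PolyTime (fun a => renameEdges (x a) (y a) (E a)) := by
  unfold renameEdges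
  exact PolyTime.map hE (by fun_prop)

@[fun_prop]
theorem polyTime_conflicts {E : α → List (Edge r V)} (hE : PolyTime E) :
    PolyTime (fun a => conflicts (E a)) := by
  unfold conflicts
  refine PolyTime.flatMap hE (PolyTime.flatMap (by fun_prop) ?_)
  fun_prop

@[fun_prop]
theorem polyTime_foldStep {s : α → V × List (Edge r V)} (hs : PolyTime s) :
    PolyTime (fun a => foldStep (s a)) := by
  unfold foldStep
  exact PolyTime.headElim (by fun_prop) hs (by fun_prop)

/-- A fold only reuses vertex names already present and keeps the number of edges, so no component
of an edge ever outgrows the initial graph. -/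
theorem esize_foldl_foldStep_le (s : V × List (Edge r V)) (l : List (Edge r V)) :
    esize (l.foldl (fun s _ => foldStep s) s) ≤ esize s + esize s * (3 * esize s + 3) + 2 := by
  have key := foldGraph_induction (fun s' => s'.2.length = s.2.length ∧ esize s'.1 ≤ esize s ∧
    ∀ e ∈ s'.2, esize e.1 ≤ esize s ∧ esize e.2.1 ≤ esize s ∧ esize e.2.2 ≤ esize s) (s := s)
    ?_ ?_ l
  · obtain ⟨h1, h2, h3⟩ := key
    generalize l.foldl (fun s _ => foldStep s) s = s' at h1 h2 h3 ⊢
    obtain ⟨b, E⟩ := s'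
    have h4 : ∀ e ∈ E, esize e ≤ 3 * esize s + 2 := by
      rintro ⟨m, a, q⟩ he
      have := h3 _ he
      simp only [esize_mk] at this ⊢
      omega
    have h5 := esize_list_le h4
    have h6 : E.length ≤ esize s := by
      have h7 := length_lt_esize s.2
      have h8 := esize_snd_le s
      simp only at h1
      omega
    have h7 : E.length * (3 * esize s + 2 + 1) ≤ esize s * (3 * esize s + 3) :=
      Nat.mul_le_mul_right _ h6
    simp only [esize_mk] at h2 ⊢
    omega
  · rintro ⟨b, E⟩ x y hxy ⟨h1, h2, h3⟩
    obtain ⟨-, m, a, hx, -⟩ := mem_conflicts.1 hxy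
    have hx' : esize x ≤ esize s := (h3 _ hx).2.2
    have hσ : ∀ v, esize v ≤ esize s → esize (rename y x v) ≤ esize s := by
      intro v hv
      simp only [rename, Bool.cond_decide]
      split_ifs
      · exact hx'
      · exact hv
    refine ⟨by simpa [renameEdges] using h1, hσ _ h2, fun e he => ?_⟩
    obtain ⟨f, hf, rfl⟩ := List.mem_map.1 he
    obtain ⟨h4, h5, h6⟩ := h3 f hf
    exact ⟨hσ _ h4, h5, hσ _ h6⟩
  · refine ⟨rfl, esize_fst_le s, fun e he => ?_⟩
    have h1 := esize_le_of_mem he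
    have h2 := esize_snd_le s
    obtain ⟨m, a, q⟩ := e
    simp only [esize_mk] at h1 ⊢
    omega

@[fun_prop]
theorem polyTime_foldGraph {s : α → V × List (Edge r V)} (hs : PolyTime s) :
    PolyTime (fun a => foldGraph (s a)) := by
  have : PolyTime (foldGraph : V × List (Edge r V) → _) := by
    unfold foldGraph
    refine PolyTime.foldl
      (Polynomial.X + Polynomial.X * (3 * Polynomial.X + 3) + 2) (by fun_prop) (by fun_prop)
      (by fun_prop) fun s l _ => ?_
    simpa using esize_foldl_foldStep_le s l
  exact this.comp hs

theorem esize_pathEdges_le (w : Word r) :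
    esize (pathEdges w) ≤ esize w * (3 * esize w + 3) + 1 := by
  have h1 : (pathEdges w).length = w.length := by
    induction w with
    | nil => rfl
    | cons a w ih => simp [pathEdges, ih]
  have h2 : ∀ e ∈ pathEdges w, esize e ≤ 3 * esize w + 2 := by
    clear h1
    induction w with
    | nil => simp [pathEdges]
    | cons a w ih =>
      intro e he
      rcases List.mem_cons.1 he with rfl | he
      · simp only [esize_mk, esize_cons]
        omega
      · have := ih e he
        rw [esize_cons]
        omega
  have h3 := esize_list_le h2
  have h4 := length_lt_esize w
  have h5 : w.length * (3 * esize w + 2 + 1) ≤ esize w * (3 * esize w + 3) :=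
    Nat.mul_le_mul_right _ h4.le
  rw [h1] at h3
  omega

@[fun_prop]
theorem polyTime_pathEdges {w : α → Word r} (hw : PolyTime w) :
    PolyTime (fun a => pathEdges (w a)) := by
  let g : Word r × List (Edge r (Word r)) → Letter r → Word r × List (Edge r (Word r)) :=
    fun s a => (a :: s.1, (s.1, a, a :: s.1) :: s.2)
  -- Consuming the word from its end rebuilds its suffixes, which are the vertices of the path,
  -- along with the edges between them.
  have key : ∀ v : Word r, v.reverse.foldl g ([], []) = (v, pathEdges v) := by
    intro v
    induction v with
    | nil => rfl
    | cons a v ih => rw [List.reverse_cons, List.foldl_append, ih]; rfl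
  have : PolyTime (fun v : Word r => (v.reverse.foldl g ([], [])).2) := by
    refine PolyTime.snd' (PolyTime.foldl (g := fun _ => g)
      (Polynomial.X + Polynomial.X * (3 * Polynomial.X + 3) + 2) (by fun_prop) (by fun_prop)
      (by fun_prop) fun v m hm => ?_)
    have h1 := key m.reverse
    have h2 := esize_le_of_prefix hm
    have h3 := esize_pathEdges_le m.reverse
    rw [List.reverse_reverse] at h1
    rw [esize_reverse] at h2 h3
    rw [h1, esize_mk, esize_reverse]
    have h4 : esize m * (3 * esize m + 3) ≤ esize v * (3 * esize v + 3) := by gcongr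
    simp only [Polynomial.eval_add, Polynomial.eval_mul, Polynomial.eval_X, Polynomial.eval_ofNat]
    omega
  simp only [key] at this
  exact this.comp hw

@[fun_prop]
theorem polyTime_roseEdges {L : α → List (Word r)} (hL : PolyTime L) :
    PolyTime (fun a => roseEdges (L a)) := by
  have h : PolyTime (fun a => loopEdges (L a)) := by
    unfold loopEdges
    exact PolyTime.flatMap hL (by fun_prop)
  unfold roseEdges
  refine h.append (PolyTime.map (g := fun _ => Edge.flip) h ?_)
  unfold Edge.flip
  fun_prop

@[fun_prop]
theorem polyTime_stallings {L : α → List (Word r)} (hL : PolyTime L) :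
    PolyTime (fun a => stallings (L a)) := by
  unfold stallings
  fun_prop

@[fun_prop]
theorem polyTime_nextLayer {E : α → List (Edge r V)} {T : α → List (V × Word r)}
    (hE : PolyTime E) (hT : PolyTime T) : PolyTime (fun a => nextLayer (E a) (T a)) := by
  unfold nextLayer
  refine PolyTime.flatMap hE (PolyTime.headElim (PolyTime.filter (by fun_prop) ?_)
    (by fun_prop) (by fun_prop))
  fun_prop

theorem esize_le_of_mem_layer {E : List (Edge r V)} {b : V} {B n : ℕ} (hE : esize E ≤ B)
    (hb : esize b ≤ B) {q : V} {w : Word r} (h : (q, w) ∈ layer E b n) :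
    esize q ≤ B ∧ esize w ≤ n * (B + 1) + 1 := by
  induction n generalizing q w with
  | zero =>
    simp only [layer, List.mem_singleton, Prod.mk.injEq] at h
    obtain ⟨rfl, rfl⟩ := h
    simp [hb]
  | succ n ih =>
    obtain ⟨m, a, v, rfl, he, hv, -⟩ := mem_nextLayer h
    have h1 := (ih hv).2
    have h2 := esize_le_of_mem he
    simp only [esize_mk] at h2
    rw [esize_cons, add_mul, one_mul]
    omega

@[fun_prop]
theorem polyTime_explore {E : α → List (Edge r V)} {b : α → V} (hE : PolyTime E)
    (hb : PolyTime b) : PolyTime (fun a => explore (E a) (b a)) := by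
  have : PolyTime (fun x : List (Edge r V) × V => explore x.1 x.2) := by
    unfold explore
    -- `S` bounds one entry, a vertex with its word, together with its list cell. Each of the two
    -- accumulated lists has at most `B * B` entries, where `B` is the input size.
    let S : Polynomial ℕ := Polynomial.X + (Polynomial.X * (Polynomial.X + 1) + 1) + 2
    refine PolyTime.fst' (PolyTime.foldl
      (2 * (Polynomial.X * Polynomial.X * S) + 3) (by fun_prop) (by fun_prop)
      (by fun_prop) fun x l hl => ?_)
    rw [explore_foldl]
    obtain ⟨E, b⟩ := x
    set B := esize (E, b) with hB
    have hEB : esize E ≤ B := esize_fst_le (E, b)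
    have hbB : esize b ≤ B := esize_snd_le (E, b)
    have hlen : l.length + 1 ≤ B := by
      have h1 := hl.length_le
      have h2 := length_lt_esize E
      simp only at h1
      omega
    have hElen : E.length + 1 ≤ B := (length_lt_esize E).trans_le hEB
    have hBpos : 1 ≤ B := one_le_esize _
    have hentry : ∀ n ≤ B, ∀ t ∈ layer E b n, esize t ≤ B + (B * (B + 1) + 1) + 1 := by
      rintro n hn ⟨q, w⟩ ht
      obtain ⟨h1, h2⟩ := esize_le_of_mem_layer hEB hbB ht
      have h3 := Nat.mul_le_mul_right (B + 1) hn
      rw [esize_mk]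
      omega
    have h1 : esize ((List.range (l.length + 1)).flatMap (layer E b)) ≤
        B * B * (B + (B * (B + 1) + 1) + 2) + 1 := by
      have h2 : ∀ t ∈ (List.range (l.length + 1)).flatMap (layer E b),
          esize t ≤ B + (B * (B + 1) + 1) + 1 := by
        intro t ht
        obtain ⟨n, hn, ht⟩ := List.mem_flatMap.1 ht
        exact hentry n (by have := List.mem_range.1 hn; omega) t ht
      refine (esize_list_le h2).trans ?_
      gcongr ?_ * _ + 1
      have h3 : ∀ n, ((List.range n).flatMap (layer E b)).length ≤ n * B := by
        intro n
        induction n with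
        | zero => simp
        | succ n ih =>
          have := length_layer_le E b n
          rw [List.range_succ, List.flatMap_append, List.length_append, List.flatMap_singleton,
            add_mul]
          omega
      exact (h3 _).trans (Nat.mul_le_mul_right B hlen)
    have h2 : esize (layer E b l.length) ≤ B * B * (B + (B * (B + 1) + 1) + 2) + 1 := by
      refine (esize_list_le (hentry _ (by omega))).trans ?_
      gcongr ?_ * _ + 1
      exact ((length_layer_le E b _).trans hElen).trans (Nat.le_mul_of_pos_left B hBpos)
    rw [esize_mk]
    simp only [S, Polynomial.eval_add, Polynomial.eval_mul, Polynomial.eval_X,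
      Polynomial.eval_ofNat, Polynomial.eval_one]
    omega
  exact this.comp (hE.pair hb)

@[fun_prop]
theorem polyTime_candidates {T₁ : α → List (V × Word r)} {T₂ : α → List (V' × Word r)}
    {T₃ : α → List ((V × V') × Word r)} (h₁ : PolyTime T₁) (h₂ : PolyTime T₂)
    (h₃ : PolyTime T₃) : PolyTime (fun a => candidates (T₁ a) (T₂ a) (T₃ a)) := by
  unfold candidates
  refine PolyTime.flatMap h₃ (PolyTime.flatMap (by fun_prop) (PolyTime.flatMap (by fun_prop) ?_))
  fun_prop

@[fun_prop]
theorem polyTime_dropLength {v w : α → Word r} (hv : PolyTime v) (hw : PolyTime w) :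
    PolyTime (fun a => dropLength (v a) (w a)) := by
  have : PolyTime (fun x : Word r × Word r => dropLength x.1 x.2) := by
    unfold dropLength
    refine PolyTime.foldl Polynomial.X (by fun_prop) (by fun_prop) (by fun_prop) fun x m _ => ?_
    have h1 := dropLength_eq m x.2
    have h2 := esize_append_add_one (x.2.take m.length) (x.2.drop m.length)
    have h3 := one_le_esize (x.2.take m.length)
    have h4 := esize_snd_le x
    rw [List.take_append_drop] at h2
    rw [dropLength] at h1
    rw [h1, Polynomial.eval_X]
    omega
  exact this.comp (hv.pair hw)

@[fun_prop]
theorem polyTime_shortest {β : Type} [Enc β] {l : α → List (β × Word r)} (hl : PolyTime l) :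
    PolyTime (fun a => shortest (l a)) := by
  have : PolyTime (shortest : List (β × Word r) → _) := by
    unfold shortest
    refine PolyTime.foldl (Polynomial.X + 1) (by fun_prop) (by fun_prop)
      (PolyTime.headElim (by fun_prop) (by fun_prop) (by fun_prop)) fun l m hm => ?_
    change esize (shortest m) ≤ _
    simp only [Polynomial.eval_add, Polynomial.eval_X, Polynomial.eval_one]
    rcases shortest_spec m with ⟨-, h⟩ | ⟨c, hc, h, -⟩
    · rw [h, esize_nil]
      omega
    · have h1 := esize_le_of_mem hc
      have h2 := esize_le_of_prefix hm
      rw [h, esize_cons, esize_nil]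
      omega
  exact this.comp hl

/-- The output format differs from the `Enc` instance of `Option`. The encoder is therefore pushed
into the branches, where on `some` it leaves the encoding of the pair unchanged. -/
theorem encodeAnswer_headElim {β : Type} (l : List β) (n : Option (Word r × Word r))
    (s : β → Option (Word r × Word r)) :
    encodeAnswer (headElim l n s) = headElim l (encodeAnswer n) fun b => encodeAnswer (s b) := by
  cases l <;> rfl

theorem polyTime_encodeAnswer_some {f : α → Word r × Word r} (hf : PolyTime f) :
    PolyTime (fun a => encodeAnswer (some (f a))) :=
  (PolyTime.of_enc_eq fun _ => rfl :
    PolyTime (fun x : Word r × Word r => encodeAnswer (some x))).comp hf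

theorem polyTime_solve :
    PolyTime (fun x : List (Word r) × List (Word r) => encodeAnswer (solve x.1 x.2)) := by
  unfold solve closest
  simp only [encodeAnswer_headElim]
  refine PolyTime.headElim (PolyTime.filter (by fun_prop) (by fun_prop))
    (PolyTime.headElim (by fun_prop) (by fun_prop) ?_) ?_
  · exact polyTime_encodeAnswer_some (by fun_prop)
  · exact polyTime_encodeAnswer_some (by fun_prop)

theorem esize_letter_le (a : Letter r) : esize a ≤ 2 * r + 5 := by
  obtain ⟨i, b⟩ := a
  have h1 : esize i = 2 * i + 1 := Data.ofNat_size i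
  have h2 : esize b ≤ 3 := Data.ofBool_size_le b
  have := i.isLt
  rw [esize_mk]
  omega

theorem esize_words_le (L : List (Word r)) :
    esize L ≤ (2 * r + 6) * (L.map fun w => w.length + 1).sum + 1 := by
  induction L with
  | nil => simp
  | cons w L ih =>
    have h : esize w ≤ w.length * (2 * r + 6) + 1 := esize_list_le fun a _ => esize_letter_le a
    rw [esize_cons, List.map_cons, List.sum_cons, mul_add, mul_add, mul_comm (2 * r + 6) w.length]
    omega

theorem esize_input_le (L M : List (Word r)) :
    esize (L, M) ≤ (2 * r + 6) * inputSize L M + 3 := by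
  have h1 := esize_words_le L
  have h2 := esize_words_le M
  rw [esize_mk, inputSize, List.map_append, List.sum_append, mul_add]
  omega

end SubgroupDistance

theorem mainTheorem9 (r : ℕ) :
    ∃ (c : TreeWhile.Cmd) (p : Polynomial ℕ),
      ∀ L M : List (SubgroupDistance.Word r),
        ∃ (o : Option (SubgroupDistance.Word r × SubgroupDistance.Word r)) (t : ℕ),
          SubgroupDistance.IsAnswer
            (SubgroupDistance.subgroupOf L) (SubgroupDistance.subgroupOf M) o ∧
          TreeWhile.Outputs c (SubgroupDistance.encodeInput L M) t
            (SubgroupDistance.encodeAnswer o) ∧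
          t ≤ p.eval (SubgroupDistance.inputSize L M) := by
  obtain ⟨p, -, h⟩ := SubgroupDistance.polyTime_solve (r := r)
  obtain ⟨c, hc⟩ := h 0
  refine ⟨c, p.comp (Polynomial.C (2 * r + 6) * Polynomial.X + 3), fun L M => ?_⟩
  obtain ⟨t, s, h1, h2, -, h3⟩ :=
    hc (TreeWhile.Store.init (SubgroupDistance.encodeInput L M)) (L, M)
      -- The prescribed input format agrees by definition with the `Enc` instance for pairs of lists
      -- of words.
      (by simp only [TreeWhile.Store.init, Function.update_self]; rfl)
  refine ⟨SubgroupDistance.solve L M, t, SubgroupDistance.solve_isAnswer L M, ⟨s, h1, h2⟩,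
    h3.trans ?_⟩
  have := TreeWhile.polynomial_eval_mono p (SubgroupDistance.esize_input_le L M)
  rw [Polynomial.eval_comp]
  simpa only [Polynomial.eval_add, Polynomial.eval_mul, Polynomial.eval_C, Polynomial.eval_X,
    Polynomial.eval_ofNat] using this
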